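/- **Theorem 1.** Let $\beta,\gamma:\mathbb Z^2\to\mathbb C$ be functions of $(l,m)$. Write $\bar f(l,m)=f(l+1,m)$, $\hat f(l,m)=\widehat f(l,m)=f(l,m+1)$, $\overset{h}{f}(l,m)=f(l,m+h)$, and put $p_h=\overset{h}{\beta}\,\overset{h}{\gamma}$. For integers $j>i\ge 0$ define $$K=\begin{pmatrix}0&\bar\beta/\beta\\ \bar\gamma/\gamma&0\end{pmatrix},\quad H=\begin{pmatrix}1/\beta&-\bar\beta/(\beta\gamma)\\-\bar\gamma/(\beta\gamma)&1/\gamma\end{pmatrix},\quad J=\begin{pmatrix}0&\bar\beta/\gamma\\ \bar\gamma/\beta&0\end{pmatrix},$$ $$D_i^{(j)}=\frac{1}{(\beta\gamma)^{j-i}}\begin{pmatrix}-1&\bar\beta/\beta\\ \bar\gamma/\gamma&-1\end{pmatrix},\qquad E_i^{(j)}=\frac{1}{(\beta\gamma)^{j-i}}H,$$ $$F_i^{(j)}=\frac{1}{(\beta\gamma)^{j-i}}\begin{pmatrix}\beta&-\bar\beta\\-\bar\gamma&\gamma\end{pmatrix},\qquad G_i^{(j)}=\frac{1}{(\beta\gamma)^{j-i}}\begin{pmatrix}-1&\bar\beta/\gamma\\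 \bar\gamma/\beta&-1\end{pmatrix}.$$ Consider unknown functions of $(l,m)$: column vectors $A_i,B_i$ and $2\times2$ matrices $P_i,Q_i^{(j)},R_i^{(j)},S_i^{(j)},T_i^{(j)}$. The recursion relations are, with $\Gamma_i=\bigl(\widehat S_i^{(i+1)}K-JS_i^{(i+1)}+F_i^{(i+1)}\bigr)^{-1}$ and, in the two equations that contain it, $j\ge i+2$, $$\text{(rr1)}\quad\begin{aligned} A_{i+1}&=\Gamma_i(\widehat B_i-JB_i),\\ P_{i+1}&=\Gamma_i\bigl(\widehat S_i^{(i+1)}H+\widehat T_i^{(i+1)}J-JT_i^{(i+1)}+G_i^{(i+1)}\bigr),\\ Q_{i+1}^{(j)}&=\Gamma_i\Bigl[\widehat S_i^{(j)}K-JS_i^{(j)}+F_i^{(j)}+\sum_{h=i+1}^{j-1}\bigl(\widehat S_i^{(h)}D_h^{(j)}+\widehat T_i^{(h)}F_h^{(j)}\bigr)\Bigr],\\ R_{i+1}^{(j)}&=\Gamma_i\Bigl[\widehat S_i^{(j)}H+\widehat T_i^{(j)}J-JT_i^{(j)}+G_i^{(j)}+\sum_{h=i+1}^{j-1}\bigl(\widehat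 S_i^{(h)}E_h^{(j)}+\widehat T_i^{(h)}G_h^{(j)}\bigr)\Bigr], \end{aligned}$$ and, with $\Lambda_i=\bigl(\widehat P_iJ-KP_i+H\bigr)^{-1}$ and $j\ge i+1$, $$\text{(rr2)}\quad\begin{aligned} B_i&=\Lambda_i(\widehat A_i-KA_i),\\ S_i^{(j)}&=\Lambda_i\Bigl[\widehat P_iF_i^{(j)}+\widehat Q_i^{(j)}K-KQ_i^{(j)}+D_i^{(j)}+\sum_{h=i+1}^{j-1}\bigl(\widehat Q_i^{(h)}D_h^{(j)}+\widehat R_i^{(h)}F_h^{(j)}\bigr)\Bigr],\\ T_i^{(j)}&=\Lambda_i\Bigl[\widehat Q_i^{(j)}H+\widehat R_i^{(j)}J-KR_i^{(j)}+\widehat P_iG_i^{(j)}+E_i^{(j)}+\sum_{h=i+1}^{j-1}\bigl(\widehat Q_i^{(h)}E_h^{(j)}+\widehat R_i^{(h)}G_h^{(j)}\bigr)\Bigr]. \end{aligned}$$ (These relations come from the compatibility condition $\widehat L_kM=\overline ML_k$ of $M=\begin{pmatrix}1&\beta\nu\\ \gamma\nu&1\end{pmatrix}$ with the matrix $L_k$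 whose diagonal entries are $\sum_{i=0}^k a_i\nu^{2i}$ and $\sum_{i=0}^k d_i\nu^{2i}$ and whose off-diagonal entries are $\sum_{i=0}^k b_i\nu^{2i+1}$ and $\sum_{i=0}^k c_i\nu^{2i+1}$.) Let $k\ge0$, and suppose that at every $(l,m)$ the denominators below do not vanish: $\beta\ne0$, $\gamma\ne0$, $p_h\neq p_0$ for $1\le h\le 2k$, and $\bar\beta\bar\gamma\ne p_n$ for $0\le n\le 2k$. Then, at every $(l,m)$, (rr1) holds for all $0\le i<k$ and (rr2) holds for all $0\le i\le k$ (in both cases for all $j$ as above, and the inverses $\Gamma_i$, $\Lambda_i$ exist) for the following formulae. Here $P_i,Q_i^{(j)},R_i^{(j)},S_i^{(j)},T_i^{(j)}$ are diagonal; only the first entries of vectors and the $[1,1]$ entries of diagonal matrices are written, and the second, respectively $[2,2]$, entries arise by interchanging $\beta$ and $\gamma$. Empty sums are $0$ and empty products are $1$. $$A_i:\ \prod_{j=1}^i\overset{2j-2}{\gamma}\,\overset{2j-1}{\beta},\qquad B_i:\ \beta\prod_{j=1}^i\overset{2j-1}{\gamma}\,\overset{2j}{\beta},\qquad P_i:\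 -\sum_{j=1}^i\Bigl(\frac{\overset{2j-2}{\gamma}}{\overset{2j-1}{\gamma}}+1\Bigr)\frac1\beta\prod_{h=1}^{j-1}\frac{\overset{2h-2}{\gamma}\,\overset{2h-1}{\beta}}{\overset{2h-1}{\gamma}\,\overset{2h}{\beta}},$$ $$S_i^{(j)}:\ \sum_{h=0}^{2i}\frac{s_i^{(h)}}{p_h^{\,j}},\qquad T_i^{(j)}:\ \sum_{h=0}^{2i}\frac{t_i^{(h)}}{p_h^{\,j}},\qquad Q_i^{(j)}:\ \sum_{h=0}^{2i-1}\frac{q_i^{(h)}}{p_h^{\,j}},\qquad R_i^{(j)}:\ \sum_{h=0}^{2i-1}\frac{r_i^{(h)}}{p_h^{\,j}},$$ $$s_i^{(h)}=-U_i^{(h)}p_h\sum_{g=0}^i\xi_{2i}^{(2g)}(\gamma)\,p_h^{\,g},\qquad t_i^{(h)}=U_i^{(h)}\sum_{g=0}^i\eta_{2i}^{(2g)}(\gamma)\,p_h^{\,g},$$ $$q_i^{(h)}=-V_i^{(h)}\sum_{g=0}^{i}\eta_{2i-1}^{(2g)}(\gamma)\,p_h^{\,g},\qquad r_i^{(h)}=V_i^{(h)}\sum_{g=0}^{i-1}\xi_{2i-1}^{(2g)}(\gamma)\,p_h^{\,g},$$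 $$U_i^{(h)}=p_h^{\,i-1}\frac{\beta\prod_{g=1}^i\overset{2g-1}{\gamma}\,\overset{2g}{\beta}}{\prod_{0\le g\le 2i,\ g\ne h}(p_g-p_h)},\qquad V_i^{(h)}=p_h^{\,i-1}\frac{\prod_{g=1}^i\overset{2g-2}{\gamma}\,\overset{2g-1}{\beta}}{\prod_{0\le g\le 2i-1,\ g\ne h}(p_h-p_g)},$$ where $\xi_a^{(b)}(\gamma)$ is the sum over all integers $a\ge h_1>h_2>\dots>h_n\ge0$, with $n=a-b$, of the alternating products $\overset{h_1}{\gamma}\,\overset{h_2}{\beta}\,\overset{h_3}{\gamma}\cdots$ of $n$ factors (equal to $1$ when $n=0$), and $\eta_a^{(b)}(\gamma)$ is the same sum with $n=a-b+1$ factors. Moreover, for these formulae, $$\Gamma_i=\frac{1}{1-\bar\beta\bar\gamma/p_{2i+1}}\begin{pmatrix}\gamma&\Gamma_{1,i}\\ \Gamma_{2,i}&\beta\end{pmatrix},\qquad \Gamma_{1,i}=\frac{\bar\beta\gamma}{\hat\gamma}\prod_{j=1}^i\frac{\overset{2j-1}{\beta}\,\overset{2j}{\gamma}}{\overset{2j}{\beta}\,\overset{2j+1}{\gamma}}\qquad(0\le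 i<k),$$ $$\Lambda_i=\frac{1}{1-\bar\beta\bar\gamma/p_{2i}}\begin{pmatrix}\beta&\Lambda_{1,i}\\ \Lambda_{2,i}&\gamma\end{pmatrix},\qquad \Lambda_{1,i}=\bar\beta\prod_{j=1}^i\frac{\overset{2j-2}{\beta}\,\overset{2j-1}{\gamma}}{\overset{2j-1}{\beta}\,\overset{2j}{\gamma}}\qquad(0\le i\le k),$$ and $\Gamma_{2,i}$, $\Lambda_{2,i}$ arise from $\Gamma_{1,i}$, $\Lambda_{1,i}$ by interchanging $\beta$ and $\gamma$. -/

import Mathlib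

open scoped Matrix

noncomputable section

namespace LMKdV

/-- A lattice function of the two discrete variables `l` and `m`.  The bar shift is `l + 1`,
the hat shift is `m + 1`. -/
abbrev Lat := ℤ → ℤ → ℂ

/-- A lattice function with values in the `2 × 2` complex matrices. -/
abbrev LatMat := ℤ → ℤ → Matrix (Fin 2) (Fin 2) ℂ

/-- A lattice function with values in the column vectors of length two. -/
abbrev LatVec := ℤ → ℤ → Fin 2 → ℂ

/-! ### The coefficients of the compatibility condition in matrix form -/

section Compatibility

variable (β γ : Lat)

def K : LatMat := fun l m =>
  !![0, β (l + 1) m / β l m;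
     γ (l + 1) m / γ l m, 0]

def H : LatMat := fun l m =>
  !![1 / β l m, -(β (l + 1) m / (β l m * γ l m));
     -(γ (l + 1) m / (β l m * γ l m)), 1 / γ l m]

def J : LatMat := fun l m =>
  !![0, β (l + 1) m / γ l m;
     γ (l + 1) m / β l m, 0]

/-- `D i j` is the matrix with lower index `i` and upper index `j`; likewise `E`, `F`, `G`. -/
def D (i j : ℕ) : LatMat := fun l m =>
  (1 / (β l m * γ l m) ^ ((j : ℤ) - (i : ℤ))) •
    !![-1, β (l + 1) m / β l m;
       γ (l + 1) m / γ l m, -1]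

def E (i j : ℕ) : LatMat := fun l m =>
  (1 / (β l m * γ l m) ^ ((j : ℤ) - (i : ℤ))) •
    !![1 / β l m, -(β (l + 1) m / (β l m * γ l m));
       -(γ (l + 1) m / (β l m * γ l m)), 1 / γ l m]

def F (i j : ℕ) : LatMat := fun l m =>
  (1 / (β l m * γ l m) ^ ((j : ℤ) - (i : ℤ))) •
    !![β l m, -(β (l + 1) m);
       -(γ (l + 1) m), γ l m]

def G (i j : ℕ) : LatMat := fun l m =>
  (1 / (β l m * γ l m) ^ ((j : ℤ) - (i : ℤ))) •
    !![-1, β (l + 1) m / γ l m;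
       γ (l + 1) m / β l m, -1]

end Compatibility

/-! ### The recursion relations -/

/-- The unknowns of the recursion relations.  `Q i j` has lower index `i` and upper index `j`;
likewise `R`, `S`, `T`. -/
structure Unknowns where
  A : ℕ → LatVec
  B : ℕ → LatVec
  P : ℕ → LatMat
  Q : ℕ → ℕ → LatMat
  R : ℕ → ℕ → LatMat
  S : ℕ → ℕ → LatMat
  T : ℕ → ℕ → LatMat

/-- The matrix whose inverse is `Γ_i`. -/
def gammaDen (β γ : Lat) (u : Unknowns) (i : ℕ) : LatMat := fun l m =>
  u.S i (i + 1) l (m + 1) * K β γ l m - J β γ l m * u.S i (i + 1) l m + F β γ i (i + 1) l m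

/-- `Γ_i`. -/
def gammaMat (β γ : Lat) (u : Unknowns) (i : ℕ) : LatMat := fun l m =>
  (gammaDen β γ u i l m)⁻¹

/-- The matrix whose inverse is `Λ_i`. -/
def lambdaDen (β γ : Lat) (u : Unknowns) (i : ℕ) : LatMat := fun l m =>
  u.P i l (m + 1) * J β γ l m - K β γ l m * u.P i l m + H β γ l m

/-- `Λ_i`. -/
def lambdaMat (β γ : Lat) (u : Unknowns) (i : ℕ) : LatMat := fun l m =>
  (lambdaDen β γ u i l m)⁻¹

/-- The first set of recursion relations, giving level `i + 1` of `A, P, Q, R` from level `i` of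
`B, S, T`, at the lattice point `(l, m)`.  It includes that the inverse `Γ_i` exists. -/
structure RecursionOne (β γ : Lat) (u : Unknowns) (i : ℕ) (l m : ℤ) : Prop where
  invertible : IsUnit (gammaDen β γ u i l m)
  A_eq : u.A (i + 1) l m =
    gammaMat β γ u i l m *ᵥ (u.B i l (m + 1) - J β γ l m *ᵥ u.B i l m)
  P_eq : u.P (i + 1) l m =
    gammaMat β γ u i l m *
      (u.S i (i + 1) l (m + 1) * H β γ l m + u.T i (i + 1) l (m + 1) * J β γ l m
        - J β γ l m * u.T i (i + 1) l m + G β γ i (i + 1) l m)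
  Q_eq : ∀ j : ℕ, i + 1 < j → u.Q (i + 1) j l m =
    gammaMat β γ u i l m *
      (u.S i j l (m + 1) * K β γ l m - J β γ l m * u.S i j l m + F β γ i j l m
        + ∑ h ∈ Finset.Ico (i + 1) j,
            (u.S i h l (m + 1) * D β γ h j l m + u.T i h l (m + 1) * F β γ h j l m))
  R_eq : ∀ j : ℕ, i + 1 < j → u.R (i + 1) j l m =
    gammaMat β γ u i l m *
      (u.S i j l (m + 1) * H β γ l m + u.T i j l (m + 1) * J β γ l m
        - J β γ l m * u.T i j l m + G β γ i j l m
        + ∑ h ∈ Finset.Ico (i + 1) j,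
            (u.S i h l (m + 1) * E β γ h j l m + u.T i h l (m + 1) * G β γ h j l m))

/-- The second set of recursion relations, giving level `i` of `B, S, T` from level `i` of
`A, P, Q, R`, at the lattice point `(l, m)`.  It includes that the inverse `Λ_i` exists. -/
structure RecursionTwo (β γ : Lat) (u : Unknowns) (i : ℕ) (l m : ℤ) : Prop where
  invertible : IsUnit (lambdaDen β γ u i l m)
  B_eq : u.B i l m =
    lambdaMat β γ u i l m *ᵥ (u.A i l (m + 1) - K β γ l m *ᵥ u.A i l m)
  S_eq : ∀ j : ℕ, i < j → u.S i j l m =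
    lambdaMat β γ u i l m *
      (u.P i l (m + 1) * F β γ i j l m + u.Q i j l (m + 1) * K β γ l m
        - K β γ l m * u.Q i j l m + D β γ i j l m
        + ∑ h ∈ Finset.Ico (i + 1) j,
            (u.Q i h l (m + 1) * D β γ h j l m + u.R i h l (m + 1) * F β γ h j l m))
  T_eq : ∀ j : ℕ, i < j → u.T i j l m =
    lambdaMat β γ u i l m *
      (u.Q i j l (m + 1) * H β γ l m + u.R i j l (m + 1) * J β γ l m
        - K β γ l m * u.R i j l m + u.P i l (m + 1) * G β γ i j l m + E β γ i j l m
        + ∑ h ∈ Finset.Ico (i + 1) j,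
            (u.Q i h l (m + 1) * E β γ h j l m + u.R i h l (m + 1) * G β γ h j l m))

/-! ### The closed-form formulae

Every scalar below is the `[1,1]` (or first) entry; the `[2,2]` (or second) entry is the same
expression with `β` and `γ` interchanged.  Products and sums over `1 ≤ j ≤ i` are written over
`0 ≤ j < i`. -/

/-- The `h`-fold shift in `m`. -/
def sh (f : Lat) (h : ℕ) : Lat := fun l m => f l (m + (h : ℤ))

/-- The nested sum over `N > h₁ > h₂ > ⋯ > hₙ ≥ 0` of the products
`u(h₁) v(h₂) u(h₃) ⋯` with `n` alternating factors; it is `1` for `n = 0`. -/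
def nested (u v : ℕ → ℂ) : ℕ → ℕ → ℂ
  | 0, _ => 1
  | n + 1, N => ∑ h ∈ Finset.range N, u h * nested v u n h

/-- `ξ_a^{(b)}(γ)`, used for `b ≤ a`: `a - b` factors, the first one a shift of `γ`. -/
def xi (β γ : Lat) (a b : ℕ) : Lat := fun l m =>
  nested (fun h => sh γ h l m) (fun h => sh β h l m) (a - b) (a + 1)

/-- `η_a^{(b)}(γ)`, used for `b ≤ a + 1`: `a - b + 1` factors, the first one a shift of `γ`. -/
def eta (β γ : Lat) (a b : ℕ) : Lat := fun l m =>
  nested (fun h => sh γ h l m) (fun h => sh β h l m) (a + 1 - b) (a + 1)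

/-- The `h`-fold shift in `m` of the product `β γ`. -/
def bg (β γ : Lat) (h : ℕ) : Lat := fun l m => sh β h l m * sh γ h l m

def solA₁ (β γ : Lat) (i : ℕ) : Lat := fun l m =>
  ∏ j ∈ Finset.range i, sh γ (2 * j) l m * sh β (2 * j + 1) l m

def solB₁ (β γ : Lat) (i : ℕ) : Lat := fun l m =>
  β l m * ∏ j ∈ Finset.range i, sh γ (2 * j + 1) l m * sh β (2 * j + 2) l m

def solP₁ (β γ : Lat) (i : ℕ) : Lat := fun l m =>
  -∑ j ∈ Finset.range i,
    (sh γ (2 * j) l m / sh γ (2 * j + 1) l m + 1) * (1 / β l m) *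
      ∏ h ∈ Finset.range j,
        (sh γ (2 * h) l m * sh β (2 * h + 1) l m) /
          (sh γ (2 * h + 1) l m * sh β (2 * h + 2) l m)

def solU (β γ : Lat) (i h : ℕ) : Lat := fun l m =>
  bg β γ h l m ^ ((i : ℤ) - 1) *
    ((β l m * ∏ g ∈ Finset.range i, sh γ (2 * g + 1) l m * sh β (2 * g + 2) l m) /
      ∏ g ∈ (Finset.range (2 * i + 1)).erase h, (bg β γ g l m - bg β γ h l m))

def solV (β γ : Lat) (i h : ℕ) : Lat := fun l m =>
  bg β γ h l m ^ ((i : ℤ) - 1) *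
    ((∏ g ∈ Finset.range i, sh γ (2 * g) l m * sh β (2 * g + 1) l m) /
      ∏ g ∈ (Finset.range (2 * i)).erase h, (bg β γ h l m - bg β γ g l m))

def sCoeff (β γ : Lat) (i h : ℕ) : Lat := fun l m =>
  -solU β γ i h l m * bg β γ h l m *
    ∑ g ∈ Finset.range (i + 1), xi β γ (2 * i) (2 * g) l m * bg β γ h l m ^ g

def tCoeff (β γ : Lat) (i h : ℕ) : Lat := fun l m =>
  solU β γ i h l m *
    ∑ g ∈ Finset.range (i + 1), eta β γ (2 * i) (2 * g) l m * bg β γ h l m ^ g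

def qCoeff (β γ : Lat) (i h : ℕ) : Lat := fun l m =>
  -solV β γ i h l m *
    ∑ g ∈ Finset.range (i + 1), eta β γ (2 * i - 1) (2 * g) l m * bg β γ h l m ^ g

def rCoeff (β γ : Lat) (i h : ℕ) : Lat := fun l m =>
  solV β γ i h l m *
    ∑ g ∈ Finset.range i, xi β γ (2 * i - 1) (2 * g) l m * bg β γ h l m ^ g

def solS₁ (β γ : Lat) (i j : ℕ) : Lat := fun l m =>
  ∑ h ∈ Finset.range (2 * i + 1), sCoeff β γ i h l m / bg β γ h l m ^ j

def solT₁ (β γ : Lat) (i j : ℕ) : Lat := fun l m =>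
  ∑ h ∈ Finset.range (2 * i + 1), tCoeff β γ i h l m / bg β γ h l m ^ j

def solQ₁ (β γ : Lat) (i j : ℕ) : Lat := fun l m =>
  ∑ h ∈ Finset.range (2 * i), qCoeff β γ i h l m / bg β γ h l m ^ j

def solR₁ (β γ : Lat) (i j : ℕ) : Lat := fun l m =>
  ∑ h ∈ Finset.range (2 * i), rCoeff β γ i h l m / bg β γ h l m ^ j

/-- The diagonal matrix with first entry `f β γ` and second entry `f γ β`. -/
def symDiag (f : Lat → Lat → Lat) (β γ : Lat) : LatMat := fun l m =>
  !![f β γ l m, 0; 0, f γ β l m]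

/-- The closed-form unknowns. -/
def solution (β γ : Lat) : Unknowns where
  A i := fun l m => ![solA₁ β γ i l m, solA₁ γ β i l m]
  B i := fun l m => ![solB₁ β γ i l m, solB₁ γ β i l m]
  P i := symDiag (fun x y => solP₁ x y i) β γ
  Q i j := symDiag (fun x y => solQ₁ x y i j) β γ
  R i j := symDiag (fun x y => solR₁ x y i j) β γ
  S i j := symDiag (fun x y => solS₁ x y i j) β γ
  T i j := symDiag (fun x y => solT₁ x y i j) β γ

def solGamma₁ (β γ : Lat) (i : ℕ) : Lat := fun l m =>
  β (l + 1) m * γ l m / γ l (m + 1) *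
    ∏ j ∈ Finset.range i,
      (sh β (2 * j + 1) l m * sh γ (2 * j + 2) l m) /
        (sh β (2 * j + 2) l m * sh γ (2 * j + 3) l m)

/-- The closed form of `Γ_i`. -/
def solGamma (β γ : Lat) (i : ℕ) : LatMat := fun l m =>
  (1 / (1 - β (l + 1) m * γ (l + 1) m / bg β γ (2 * i + 1) l m)) •
    !![γ l m, solGamma₁ β γ i l m;
       solGamma₁ γ β i l m, β l m]

def solLambda₁ (β γ : Lat) (i : ℕ) : Lat := fun l m =>
  β (l + 1) m *
    ∏ j ∈ Finset.range i,
      (sh β (2 * j) l m * sh γ (2 * j + 1) l m) /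
        (sh β (2 * j + 1) l m * sh γ (2 * j + 2) l m)

/-- The closed form of `Λ_i`. -/
def solLambda (β γ : Lat) (i : ℕ) : LatMat := fun l m =>
  (1 / (1 - β (l + 1) m * γ (l + 1) m / bg β γ (2 * i) l m)) •
    !![β l m, solLambda₁ β γ i l m;
       solLambda₁ γ β i l m, γ l m]

end LMKdV

end

/-! Fix a lattice point and put b_h, g_h for the forward m-shifts of β, γ there, with p_h = b_h g_h.
All the unknowns belong to one chain indexed by a number N of sites, with N = 2i for A, P, Q, R and
N = 2i+1 for B, S, T. A and B are the alternating products `altProd` of N factors; Q and S are the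
partial fraction sums `evenSum`; R and T are `oddSum`; and P_i is R_i^{(i)}. The numerators at the
pole p_h are the even and odd generating functions of nested alternating sums (`transfer`) at w =
1/p_h, so both recursion relations become one passage from N to N+1.

Adding a site, at the bottom (the hat shift) or at the top, acts on the pair of generating functions
by a 2×2 matrix of determinant 1 - w p_a, where a is the added site. The residue weights of N and
N+1 poles differ by this same factor, up to a constant, and at w = 1/p_a it kills the superfluous
pole. Inverting the matrix residue by residue gives four linear relations, collected in
`levelRelations`: two compare N+1 sites with the shifted N sites, two compare them with the
unshifted N sites and β, γ interchanged.

Eliminating between the first two relations leaves a first-order recurrence in j, which evaluates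
the sums over h in the recursion relations. Its initial values are Q_i^{(i)} = 1 for i > 0 and
T_i^{(i)} = 1, obtained from Lagrange interpolation. The same values identify the matrices to be
inverted: their off-diagonal entries involve the two `ratio` constants of the level, whose product
is 1/p_N, and this produces the denominator 1 - β̄γ̄/p_N. The recursions are then checked entrywise
after multiplying the inverse away. -/

noncomputable section

namespace LMKdV

/-! ### Alternating products and transfer recursions -/

/-- The alternating product `u (N - 1) * v (N - 2) * u (N - 3) * ⋯` of `N` factors. -/
def altProd (u v : ℕ → ℂ) : ℕ → ℂ
  | 0 => 1
  | N + 1 => u N * altProd v u N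

/-- The generating functions in `w` of the nested sums over `N` sites with an even, respectively
odd, number of factors. -/
def transfer (w : ℂ) (u v : ℕ → ℂ) : ℕ → ℂ × ℂ
  | 0 => (1, 0)
  | N + 1 => ((transfer w u v N).1 + w * u N * (transfer w v u N).2,
      (transfer w u v N).2 + u N * (transfer w v u N).1)

/-- The sequence shifted by one. -/
def shift (u : ℕ → ℂ) : ℕ → ℂ := fun h => u (h + 1)

/-- The first entry of `u` or `v`, according to the parity of `N`. -/
def firstFactor (u v : ℕ → ℂ) (N : ℕ) : ℂ := if Even N then u 0 else v 0

theorem altProd_succ (u v : ℕ → ℂ) (N : ℕ) : altProd u v (N + 1) = u N * altProd v u N := rfl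

theorem altProd_ne_zero {u v : ℕ → ℂ} (hu : ∀ h, u h ≠ 0) (hv : ∀ h, v h ≠ 0) (N : ℕ) :
    altProd u v N ≠ 0 := by
  induction N generalizing u v with
  | zero => exact one_ne_zero
  | succ N ih => exact mul_ne_zero (hu N) (ih hv hu)

theorem altProd_mul_swap (u v : ℕ → ℂ) (N : ℕ) :
    altProd u v N * altProd v u N = ∏ h ∈ Finset.range N, u h * v h := by
  induction N generalizing u v with
  | zero => simp [altProd]
  | succ N ih =>
    rw [Finset.prod_range_succ, ← ih u v, altProd_succ, altProd_succ]
    ring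

/-- Peels the factor at site 0 instead of the one at the top. Which sequence it comes from depends
on parity, and this is the only difference between the two kinds of recursion step. -/
theorem altProd_succ_shift (u v : ℕ → ℂ) (N : ℕ) :
    altProd u v (N + 1) = firstFactor u v N * altProd (shift u) (shift v) N := by
  induction N generalizing u v with
  | zero => simp [altProd, firstFactor]
  | succ N ih =>
    rw [altProd_succ, ih v u, altProd_succ]
    have : firstFactor u v (N + 1) = firstFactor v u N := by
      unfold firstFactor
      by_cases h : Even N <;> simp [h, Nat.even_add_one]
    rw [this]
    simp only [shift]
    ring

theorem transfer_succ_fst (w : ℂ) (u v : ℕ → ℂ) (N : ℕ) :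
    (transfer w u v (N + 1)).1 = (transfer w u v N).1 + w * u N * (transfer w v u N).2 := rfl

theorem transfer_succ_snd (w : ℂ) (u v : ℕ → ℂ) (N : ℕ) :
    (transfer w u v (N + 1)).2 = (transfer w u v N).2 + u N * (transfer w v u N).1 := rfl

/-- A new bottom site leaves the alternation above it intact: even products can only end in `v 0`,
odd ones in `u 0`. The resulting matrix has determinant `1 - w * u 0 * v 0`. -/
theorem transfer_succ_shift (w : ℂ) (u v : ℕ → ℂ) (N : ℕ) :
    (transfer w u v (N + 1)).1 = (transfer w (shift u) (shift v) N).1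
        + w * v 0 * (transfer w (shift u) (shift v) N).2 ∧
      (transfer w u v (N + 1)).2 = (transfer w (shift u) (shift v) N).2
        + u 0 * (transfer w (shift u) (shift v) N).1 := by
  induction N generalizing u v with
  | zero => simp [transfer]
  | succ N ih =>
    obtain ⟨h1, h2⟩ := ih u v
    obtain ⟨h3, h4⟩ := ih v u
    constructor
    · rw [transfer_succ_fst, h1, h4, transfer_succ_fst, transfer_succ_snd]
      simp only [shift]
      ring
    · rw [transfer_succ_snd, h2, h3, transfer_succ_fst, transfer_succ_snd]
      simp only [shift]
      ring

/-! ### Nested sums -/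

theorem nested_zero_right (u v : ℕ → ℂ) (n : ℕ) : nested u v (n + 1) 0 = 0 := by
  simp [nested]

theorem nested_succ_succ (u v : ℕ → ℂ) (n N : ℕ) :
    nested u v (n + 1) (N + 1) = nested u v (n + 1) N + u N * nested v u n N := by
  simp [nested, Finset.sum_range_succ]

theorem nested_eq_zero (u v : ℕ → ℂ) {n N : ℕ} (h : N < n) : nested u v n N = 0 := by
  induction N generalizing u v n with
  | zero =>
    obtain ⟨n, rfl⟩ := Nat.exists_eq_succ_of_ne_zero h.ne'
    exact nested_zero_right u v n
  | succ N ih =>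
    obtain ⟨n, rfl⟩ := Nat.exists_eq_succ_of_ne_zero (Nat.ne_zero_of_lt h)
    rw [Nat.succ_eq_add_one, nested_succ_succ, ih u v (by omega), ih v u (by omega)]
    simp

theorem nested_self (u v : ℕ → ℂ) (N : ℕ) : nested u v N N = altProd u v N := by
  induction N generalizing u v with
  | zero => rfl
  | succ N ih => rw [nested_succ_succ, nested_eq_zero u v (Nat.lt_succ_self N), ih, altProd_succ,
      zero_add]

/-- The bounds on `N` ensure that every nonzero nested sum of the given parity is included; longer
products on `N` sites vanish. -/
theorem sum_nested (w : ℂ) (u v : ℕ → ℂ) (N M : ℕ) :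
    (N ≤ 2 * M + 1 →
      ∑ n ∈ Finset.range (M + 1), nested u v (2 * n) N * w ^ n = (transfer w u v N).1) ∧
    (N ≤ 2 * M →
      ∑ n ∈ Finset.range M, nested u v (2 * n + 1) N * w ^ n = (transfer w u v N).2) := by
  induction N generalizing u v M with
  | zero =>
    constructor
    · intro _
      rw [Finset.sum_range_succ']
      simp [transfer, nested, mul_add]
    · intro _
      simp [transfer, nested]
  | succ N ih =>
    constructor
    · intro h
      rw [transfer_succ_fst, ← (ih u v M).1 (by omega), ← (ih v u M).2 (by omega),
        Finset.sum_range_succ', Finset.sum_range_succ', Finset.mul_sum, add_right_comm,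
        ← Finset.sum_add_distrib]
      congr 1
      refine Finset.sum_congr rfl fun n _ => ?_
      rw [show 2 * (n + 1) = (2 * n + 1) + 1 by ring, nested_succ_succ]
      ring
    · intro h
      obtain ⟨M, rfl⟩ : ∃ M', M = M' + 1 := ⟨M - 1, by omega⟩
      rw [transfer_succ_snd, ← (ih u v (M + 1)).2 (by omega), ← (ih v u M).1 (by omega),
        Finset.mul_sum, ← Finset.sum_add_distrib]
      refine Finset.sum_congr rfl fun n _ => ?_
      rw [nested_succ_succ]
      ring

/-- The closed forms list the coefficients by the number of omitted factors; reversing the order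
turns them into a polynomial in `1 / z`. -/
theorem sum_nested_even {z : ℂ} (hz : z ≠ 0) (u v : ℕ → ℂ) {N i : ℕ} (h : N ≤ 2 * i + 1) :
    ∑ g ∈ Finset.range (i + 1), nested u v (2 * i - 2 * g) N * z ^ g =
      z ^ i * (transfer (1 / z) u v N).1 := by
  rw [← (sum_nested (1 / z) u v N i).1 h, ← Finset.sum_range_reflect, Finset.mul_sum]
  refine Finset.sum_congr rfl fun n hn => ?_
  have hn : n ≤ i := Nat.lt_succ_iff.1 (Finset.mem_range.1 hn)
  rw [show 2 * i - 2 * (i + 1 - 1 - n) = 2 * n by omega, show i + 1 - 1 - n = i - n by omega,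
    pow_sub₀ z hz hn]
  simp only [one_div, inv_pow]
  ring

theorem sum_nested_odd {z : ℂ} (hz : z ≠ 0) (u v : ℕ → ℂ) {N i : ℕ} (h : N ≤ 2 * i) :
    z * ∑ g ∈ Finset.range i, nested u v (2 * i - 1 - 2 * g) N * z ^ g =
      z ^ i * (transfer (1 / z) u v N).2 := by
  rw [← (sum_nested (1 / z) u v N i).2 h, ← Finset.sum_range_reflect, Finset.mul_sum,
    Finset.mul_sum]
  refine Finset.sum_congr rfl fun n hn => ?_
  have hn : n < i := Finset.mem_range.1 hn
  rw [show 2 * i - 1 - 2 * (i - 1 - n) = 2 * n + 1 by omega]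
  have : z ^ i = z * z ^ (i - 1 - n) * z ^ n := by
    rw [← pow_succ', ← pow_add]
    congr 1
    omega
  rw [this, one_div, inv_pow]
  field_simp

/-! ### Partial fraction sums and their relations -/

/-- The common factor of the residues at the `h`-th pole. -/
def weight (b g : ℕ → ℂ) (N h : ℕ) : ℂ :=
  altProd b g N * (b h * g h) ^ N /
    ∏ a ∈ (Finset.range N).erase h, (b h * g h - b a * g a)

/-- The common closed form of `Q` and `S`. -/
def evenSum (b g : ℕ → ℂ) (N j : ℕ) : ℂ :=
  ∑ h ∈ Finset.range N,
    -(weight b g N h * (transfer (1 / (b h * g h)) g b N).1 / (b h * g h) ^ (j + 1))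

/-- The common closed form of `R` and `T`. -/
def oddSum (b g : ℕ → ℂ) (N j : ℕ) : ℂ :=
  ∑ h ∈ Finset.range N,
    weight b g N h * (transfer (1 / (b h * g h)) g b N).2 / (b h * g h) ^ (j + 2)

/-- The ratio of consecutive alternating products that enters the inverse matrices. -/
def ratio (b g : ℕ → ℂ) (N : ℕ) : ℂ := -(altProd g b N / altProd g b (N + 1))

/-- The pointwise non-degeneracy needed for the sums up to `N + 1` poles. -/
structure Admissible (b g : ℕ → ℂ) (N : ℕ) : Prop where
  left : ∀ h, b h ≠ 0
  right : ∀ h, g h ≠ 0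
  distinct : ∀ h ≤ N, ∀ a ≤ N, a ≠ h → b h * g h ≠ b a * g a

section Relations

variable {b g : ℕ → ℂ} {N : ℕ}

theorem Admissible.swap (H : Admissible b g N) : Admissible g b N :=
  ⟨H.right, H.left, fun h hh a ha hne => by
    rw [mul_comm (g h), mul_comm (g a)]; exact H.distinct h hh a ha hne⟩

theorem Admissible.ne_zero (H : Admissible b g N) (h : ℕ) : b h * g h ≠ 0 :=
  mul_ne_zero (H.left h) (H.right h)

theorem prod_erase_eq_prod_ite (f : ℕ → ℂ) (s : Finset ℕ) (h : ℕ) :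
    ∏ a ∈ s.erase h, f a = ∏ a ∈ s, if a = h then 1 else f a := by
  rw [← Finset.prod_erase s (a := h) (by simp)]
  refine Finset.prod_congr rfl fun a ha => ?_
  rw [if_neg (Finset.ne_of_mem_erase ha)]

/-- Adding pole 0 divides the weight by `p (h+1) - p 0` and adds one power of `p (h+1)`, where `p a
= b a * g a`; together these are the inverse of the determinant factor. -/
theorem weight_shift (H : Admissible b g N) {h : ℕ} (hh : h < N) :
    firstFactor b g N * weight (shift b) (shift g) N h =
      weight b g (N + 1) (h + 1) * (1 - b 0 * g 0 / (b (h + 1) * g (h + 1))) := by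
  have hz : b (h + 1) * g (h + 1) ≠ 0 := H.ne_zero _
  have hd : b (h + 1) * g (h + 1) - b 0 * g 0 ≠ 0 :=
    sub_ne_zero.2 (H.distinct _ (by omega) _ (by omega) (by omega))
  have hprod : ∏ a ∈ (Finset.range (N + 1)).erase (h + 1),
      (b (h + 1) * g (h + 1) - b a * g a) = (b (h + 1) * g (h + 1) - b 0 * g 0) *
        ∏ a ∈ (Finset.range N).erase h,
          (b (h + 1) * g (h + 1) - b (a + 1) * g (a + 1)) := by
    rw [prod_erase_eq_prod_ite, prod_erase_eq_prod_ite, Finset.prod_range_succ']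
    simp [mul_comm]
  simp only [weight, hprod, altProd_succ_shift, shift]
  generalize b (h + 1) * g (h + 1) = z at *
  generalize ∏ a ∈ (Finset.range N).erase h, (z - b (a + 1) * g (a + 1)) = P
  rw [one_sub_div hz, mul_comm (z - b 0 * g 0) P, ← div_div, div_mul_div_comm,
    mul_div_assoc, pow_succ]
  field_simp

theorem weight_top (H : Admissible b g N) {h : ℕ} (hh : h < N) :
    weight g b N h = -ratio b g N * weight g b (N + 1) h * (1 - b N * g N / (b h * g h)) := by
  have hz : g h * b h ≠ 0 := H.swap.ne_zero _
  have hd : g h * b h - g N * b N ≠ 0 :=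
    sub_ne_zero.2 (H.swap.distinct _ (by omega) _ (by omega) (by omega))
  have hprod : ∏ a ∈ (Finset.range (N + 1)).erase h, (g h * b h - g a * b a) =
      (∏ a ∈ (Finset.range N).erase h, (g h * b h - g a * b a)) * (g h * b h - g N * b N) := by
    rw [prod_erase_eq_prod_ite, prod_erase_eq_prod_ite, Finset.prod_range_succ,
      if_neg (by omega : N ≠ h)]
  have hA := altProd_ne_zero H.right H.left (N + 1)
  simp only [weight, hprod, ratio, neg_neg, mul_comm (b _) (g _)]
  generalize g h * b h = z at *
  generalize ∏ a ∈ (Finset.range N).erase h, (z - g a * b a) = P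
  rw [one_sub_div hz, ← div_div, pow_succ]
  field_simp

theorem weight_swap (H : Admissible b g N) (h : ℕ) :
    weight b g (N + 1) h = -ratio b g N * b N * weight g b (N + 1) h := by
  have hA := altProd_ne_zero H.right H.left (N + 1)
  simp only [weight, ratio, mul_comm (b _) (g _), altProd_succ b g]
  field_simp

theorem evenSum_shift (H : Admissible b g N) (j : ℕ) :
    firstFactor b g N * evenSum (shift b) (shift g) N j =
      ∑ h ∈ Finset.range (N + 1), -(weight b g (N + 1) h * (1 - b 0 * g 0 / (b h * g h)) *
        (transfer (1 / (b h * g h)) (shift g) (shift b) N).1 / (b h * g h) ^ (j + 1)) := by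
  -- The determinant factor vanishes at pole 0, so the term `h = 0` drops out.
  rw [Finset.sum_range_succ', div_self (H.ne_zero 0), evenSum, Finset.mul_sum]
  simp only [sub_self, mul_zero, zero_mul, zero_div, neg_zero, add_zero]
  refine Finset.sum_congr rfl fun h hh => ?_
  rw [← weight_shift H (Finset.mem_range.1 hh)]
  simp only [shift]
  ring

theorem oddSum_shift (H : Admissible b g N) (j : ℕ) :
    firstFactor b g N * oddSum (shift b) (shift g) N j =
      ∑ h ∈ Finset.range (N + 1), weight b g (N + 1) h * (1 - b 0 * g 0 / (b h * g h)) *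
        (transfer (1 / (b h * g h)) (shift g) (shift b) N).2 / (b h * g h) ^ (j + 2) := by
  rw [Finset.sum_range_succ', div_self (H.ne_zero 0), oddSum, Finset.mul_sum]
  simp only [sub_self, mul_zero, zero_mul, zero_div, add_zero]
  refine Finset.sum_congr rfl fun h hh => ?_
  rw [← weight_shift H (Finset.mem_range.1 hh)]
  simp only [shift]
  ring

theorem evenSum_top (H : Admissible b g N) (j : ℕ) :
    evenSum g b N j =
      ∑ h ∈ Finset.range (N + 1), ratio b g N * weight g b (N + 1) h *
        (1 - b N * g N / (b h * g h)) *
          (transfer (1 / (b h * g h)) b g N).1 / (b h * g h) ^ (j + 1) := by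
  rw [Finset.sum_range_succ, div_self (H.ne_zero N), evenSum]
  simp only [sub_self, mul_zero, zero_mul, zero_div, add_zero]
  refine Finset.sum_congr rfl fun h hh => ?_
  rw [weight_top H (Finset.mem_range.1 hh), mul_comm (g h)]
  ring

theorem oddSum_top (H : Admissible b g N) (j : ℕ) :
    oddSum g b N j =
      ∑ h ∈ Finset.range (N + 1), -(ratio b g N * weight g b (N + 1) h *
        (1 - b N * g N / (b h * g h)) *
          (transfer (1 / (b h * g h)) b g N).2 / (b h * g h) ^ (j + 2)) := by
  rw [Finset.sum_range_succ, div_self (H.ne_zero N), oddSum]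
  simp only [sub_self, mul_zero, zero_mul, zero_div, neg_zero, add_zero]
  refine Finset.sum_congr rfl fun h hh => ?_
  rw [weight_top H (Finset.mem_range.1 hh), mul_comm (g h)]
  ring

/-- At each pole this is one row of the adjugate of the bottom-site matrix: the odd part of the
shifted generating function cancels and the even part is multiplied by the determinant. The next
lemma is the other row. -/
theorem left_mul_oddSum_succ (H : Admissible b g N) (j : ℕ) :
    b 0 * oddSum b g (N + 1) j =
      firstFactor b g N * evenSum (shift b) (shift g) N j - evenSum b g (N + 1) j := by
  rw [evenSum_shift H, oddSum, evenSum, Finset.mul_sum, ← Finset.sum_sub_distrib]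
  refine Finset.sum_congr rfl fun h _ => ?_
  have hz := H.ne_zero h
  rw [(transfer_succ_shift _ g b N).1, (transfer_succ_shift _ g b N).2]
  generalize b h * g h = z at *
  field_simp
  ring

theorem right_mul_evenSum_succ (H : Admissible b g N) (j : ℕ) :
    g 0 * evenSum b g (N + 1) (j + 1) =
      firstFactor b g N * oddSum (shift b) (shift g) N j - oddSum b g (N + 1) j := by
  rw [oddSum_shift H, oddSum, evenSum, Finset.mul_sum, ← Finset.sum_sub_distrib]
  refine Finset.sum_congr rfl fun h _ => ?_
  have hz := H.ne_zero h
  rw [(transfer_succ_shift _ g b N).1, (transfer_succ_shift _ g b N).2]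
  generalize b h * g h = z at *
  field_simp
  ring

/-- The same cancellation at the top site. That site is peeled off both alternations, so β and γ are
interchanged on one side, and `ratio` compares the two normalizing products. -/
theorem ratio_mul_evenSum_succ (H : Admissible b g N) (j : ℕ) :
    ratio b g N * evenSum g b (N + 1) j = oddSum b g (N + 1) j - evenSum g b N j := by
  rw [evenSum_top H, oddSum, evenSum, Finset.mul_sum, ← Finset.sum_sub_distrib]
  refine Finset.sum_congr rfl fun h _ => ?_
  have hz := H.ne_zero h
  rw [weight_swap H, mul_comm (g h), transfer_succ_fst, transfer_succ_snd]
  generalize b h * g h = z at *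
  field_simp
  ring

theorem ratio_mul_oddSum_succ (H : Admissible b g N) (j : ℕ) :
    ratio b g N * oddSum g b (N + 1) j = evenSum b g (N + 1) (j + 1) - oddSum g b N j := by
  rw [oddSum_top H, oddSum, evenSum, Finset.mul_sum, ← Finset.sum_sub_distrib]
  refine Finset.sum_congr rfl fun h _ => ?_
  have hz := H.ne_zero h
  rw [weight_swap H, mul_comm (g h), transfer_succ_fst, transfer_succ_snd]
  generalize b h * g h = z at *
  field_simp
  ring

theorem ratio_mul_ratio_swap (H : Admissible b g N) :
    ratio b g N * ratio g b N = 1 / (b N * g N) := by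
  have h1 := altProd_ne_zero H.left H.right N
  have h2 := altProd_ne_zero H.right H.left N
  have h3 := H.left N
  have h4 := H.right N
  simp only [ratio, altProd_succ]
  field_simp

end Relations

/-! ### Normalization of the partial fraction sums -/

open Polynomial in
-- This is the vanishing of the total residue of `f / (X * q)`, where `q` has roots `p h`: the
-- degree bound removes infinity, and the pole at 0 gives the right-hand side.
theorem sum_eval_div_mul_prod {p : ℕ → ℂ} {N : ℕ} (hp : Set.InjOn p (Finset.range N))
    (h0 : ∀ h, p h ≠ 0) {f : ℂ[X]} (hf : f.degree < N) :
    ∑ h ∈ Finset.range N, f.eval (p h) / (p h * ∏ a ∈ (Finset.range N).erase h, (p h - p a)) =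
      -(f.eval 0 / ∏ a ∈ Finset.range N, -p a) := by
  set q : ℂ[X] := ∏ a ∈ Finset.range N, (X - C (p a)) with hq
  have hq0 : q.eval 0 = ∏ a ∈ Finset.range N, -p a := by simp [hq, eval_prod]
  have hqne : q.eval 0 ≠ 0 := by
    rw [hq0]
    exact Finset.prod_ne_zero_iff.2 fun a _ => neg_ne_zero.2 (h0 a)
  have hqm : q.Monic := monic_prod_of_monic _ _ fun a _ => monic_X_sub_C _
  have hqd : q.natDegree = N := by
    rw [hq, natDegree_prod_of_monic _ _ fun a _ => monic_X_sub_C _]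
    simp
  -- This combination vanishes at 0. Its quotient by `X` therefore has degree below `N`, takes
  -- values proportional to `f (p h) / p h` at the nodes, and has coefficient `f.eval 0` in degree
  -- `N - 1`, which Lagrange interpolation recovers.
  set r : ℂ[X] := C (f.eval 0) * q - C (q.eval 0) * f with hr
  have hrc : r.coeff N = f.eval 0 := by
    have h1 : q.coeff N = 1 := by
      have := hqm.coeff_natDegree
      rwa [hqd] at this
    simp [hr, h1, coeff_eq_zero_of_degree_lt hf]
  have hrd : r.degree ≤ N := by
    refine (degree_sub_le _ _).trans (max_le ?_ ?_)
    · rw [← smul_eq_C_mul]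
      refine (degree_smul_le _ _).trans ?_
      rw [degree_eq_natDegree hqm.ne_zero, hqd]
    · rw [← smul_eq_C_mul]
      exact (degree_smul_le _ _).trans hf.le
  have hr0 : r.coeff 0 = 0 := by
    rw [coeff_zero_eq_eval_zero]
    simp [hr, mul_comm]
  have hX : r.divX * X = r := by
    have := divX_mul_X_add r
    rwa [hr0, C_0, add_zero] at this
  have hev : ∀ h ∈ Finset.range N, r.divX.eval (p h) = -(q.eval 0 * f.eval (p h) / p h) := by
    intro h hh
    have h1 : r.divX.eval (p h) * p h = r.eval (p h) := by
      conv_rhs => rw [← hX]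
      simp
    have h2 : q.eval (p h) = 0 := by
      rw [hq, eval_prod]
      exact Finset.prod_eq_zero hh (by simp)
    have h3 : r.eval (p h) = -(q.eval 0 * f.eval (p h)) := by simp [hr, h2]
    rw [h3] at h1
    have := h0 h
    field_simp
    exact h1
  rcases Nat.eq_zero_or_pos N with rfl | hN
  · have : f = 0 := by
      rw [← degree_eq_bot]
      exact Nat.WithBot.lt_zero_iff.1 (by exact_mod_cast hf)
    simp [this]
  have hdd : r.divX.degree < (Finset.range N).card := by
    rw [Finset.card_range]
    have h1 : r.divX.natDegree < N := by
      rw [natDegree_divX_eq_natDegree_tsub_one]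
      have := natDegree_le_of_degree_le hrd
      omega
    exact (degree_le_natDegree).trans_lt (by exact_mod_cast h1)
  have hL := Lagrange.coeff_eq_sum hp hdd
  rw [Finset.card_range, coeff_divX, Nat.sub_add_cancel hN, hrc] at hL
  rw [← hq0, hL, ← mul_right_inj' hqne, mul_neg, mul_div_cancel₀ _ hqne, Finset.mul_sum,
    ← Finset.sum_neg_distrib]
  refine Finset.sum_congr rfl fun h hh => ?_
  rw [hev h hh]
  have := h0 h
  rw [neg_div, neg_neg, div_div, mul_div_assoc]

theorem degree_sum_monomial_lt (c : ℕ → ℂ) {n N : ℕ} (h : n ≤ N) :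
    (∑ g ∈ Finset.range n, Polynomial.monomial g (c g)).degree < N := by
  rw [← Polynomial.mem_degreeLT]
  refine Submodule.sum_mem _ fun g hg => Polynomial.mem_degreeLT.2 ?_
  refine (Polynomial.degree_monomial_le _ _).trans_lt ?_
  have := Finset.mem_range.1 hg
  exact_mod_cast (by omega : g < N)

theorem eval_sum_monomial (c : ℕ → ℂ) (n : ℕ) (z : ℂ) :
    (∑ g ∈ Finset.range n, Polynomial.monomial g (c g)).eval z =
      ∑ g ∈ Finset.range n, c g * z ^ g := by
  simp [Polynomial.eval_finsetSum]

section Normalization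

variable {b g : ℕ → ℂ} {N i : ℕ}

theorem Admissible.injOn (H : Admissible b g N) {n : ℕ} (hn : n ≤ N + 1) :
    Set.InjOn (fun h => b h * g h) (Finset.range n) := by
  intro x hx y hy hxy
  have hx' := Finset.mem_range.1 (Finset.mem_coe.1 hx)
  have hy' := Finset.mem_range.1 (Finset.mem_coe.1 hy)
  by_contra hne
  exact H.distinct x (by omega) y (by omega) (Ne.symm hne) hxy

theorem prod_neg_even (p : ℕ → ℂ) (i : ℕ) :
    ∏ a ∈ Finset.range (2 * i), -p a = ∏ a ∈ Finset.range (2 * i), p a := by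
  rw [Finset.prod_neg]
  simp

/-- At `j = i` the powers of the pole leave exactly `1 / p h` times a polynomial of degree at most
`i`. Its value at 0 is the full alternating product, which cancels the normalization. For `i = 0`
the sum is empty. -/
theorem evenSum_two_mul_self (H : Admissible b g N) (hi : 0 < i) (hN : 2 * i ≤ N + 1) :
    evenSum b g (2 * i) i = 1 := by
  have h := sum_eval_div_mul_prod (H.injOn hN) H.ne_zero
    (degree_sum_monomial_lt (fun n => nested g b (2 * i - 2 * n) (2 * i))
      (show i + 1 ≤ 2 * i by omega))
  simp only [eval_sum_monomial] at h
  have h0 : ∑ n ∈ Finset.range (i + 1), nested g b (2 * i - 2 * n) (2 * i) * (0 : ℂ) ^ n =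
      altProd g b (2 * i) := by
    rw [Finset.sum_range_succ']
    simp [nested_self]
  rw [prod_neg_even, ← altProd_mul_swap, h0] at h
  have h1 := altProd_ne_zero H.left H.right (2 * i)
  have h2 := altProd_ne_zero H.right H.left (2 * i)
  have key : evenSum b g (2 * i) i = -altProd b g (2 * i) * ∑ h ∈ Finset.range (2 * i),
      (∑ n ∈ Finset.range (i + 1), nested g b (2 * i - 2 * n) (2 * i) * (b h * g h) ^ n) /
        ((b h * g h) * ∏ a ∈ (Finset.range (2 * i)).erase h, (b h * g h - b a * g a)) := by
    rw [evenSum, Finset.mul_sum]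
    refine Finset.sum_congr rfl fun h _ => ?_
    have hz := H.ne_zero h
    rw [sum_nested_even hz g b (by omega), weight]
    generalize b h * g h = z at *
    rw [two_mul, pow_add]
    field_simp
    ring
  rw [key, h]
  field_simp

theorem oddSum_two_mul_self (H : Admissible b g N) (hi : 0 < i) (hN : 2 * i ≤ N + 1) :
    oddSum b g (2 * i) i = -(nested g b (2 * i - 1) (2 * i) / altProd g b (2 * i)) := by
  have h := sum_eval_div_mul_prod (H.injOn hN) H.ne_zero
    (degree_sum_monomial_lt (fun n => nested g b (2 * i - 1 - 2 * n) (2 * i))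
      (show i ≤ 2 * i by omega))
  simp only [eval_sum_monomial] at h
  rw [prod_neg_even, ← altProd_mul_swap] at h
  have h0 : ∑ n ∈ Finset.range i, nested g b (2 * i - 1 - 2 * n) (2 * i) * (0 : ℂ) ^ n =
      nested g b (2 * i - 1) (2 * i) := by
    obtain ⟨i, rfl⟩ : ∃ i', i = i' + 1 := ⟨i - 1, by omega⟩
    rw [Finset.sum_range_succ']
    simp
  rw [h0] at h
  have h1 := altProd_ne_zero H.left H.right (2 * i)
  have h2 := altProd_ne_zero H.right H.left (2 * i)
  have key : oddSum b g (2 * i) i = altProd b g (2 * i) * ∑ h ∈ Finset.range (2 * i),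
      (∑ n ∈ Finset.range i, nested g b (2 * i - 1 - 2 * n) (2 * i) * (b h * g h) ^ n) /
        ((b h * g h) * ∏ a ∈ (Finset.range (2 * i)).erase h, (b h * g h - b a * g a)) := by
    rw [oddSum, Finset.mul_sum]
    refine Finset.sum_congr rfl fun h _ => ?_
    have hz := H.ne_zero h
    have hs := sum_nested_odd hz g b (le_refl (2 * i))
    rw [mul_comm, ← eq_div_iff hz] at hs
    rw [hs, weight]
    generalize b h * g h = z at *
    rw [two_mul, pow_add]
    field_simp
    ring
  rw [key, h]
  field_simp

/-- No factor `1 / p h` survives here, so the sum is a multiple of the coefficient of degree `2 * i`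
of a polynomial of degree at most `i`, which is zero for `i > 0`. -/
theorem evenSum_two_mul_add_one_self (H : Admissible b g N) (hi : 0 < i)
    (hN : 2 * i + 1 ≤ N + 1) : evenSum b g (2 * i + 1) i = 0 := by
  have h := Lagrange.coeff_eq_sum (H.injOn hN)
    (show (∑ n ∈ Finset.range (i + 1), Polynomial.monomial n
        (nested g b (2 * i - 2 * n) (2 * i + 1))).degree < (Finset.range (2 * i + 1)).card by
      rw [Finset.card_range]
      exact degree_sum_monomial_lt _ (by omega))
  have hd : (∑ n ∈ Finset.range (i + 1), Polynomial.monomial n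
      (nested g b (2 * i - 2 * n) (2 * i + 1))).degree < (2 * i : ℕ) :=
    degree_sum_monomial_lt _ (by omega)
  rw [Finset.card_range, Nat.add_sub_cancel, Polynomial.coeff_eq_zero_of_degree_lt hd] at h
  simp only [eval_sum_monomial] at h
  have key : evenSum b g (2 * i + 1) i = -altProd b g (2 * i + 1) *
      ∑ h ∈ Finset.range (2 * i + 1),
      (∑ n ∈ Finset.range (i + 1), nested g b (2 * i - 2 * n) (2 * i + 1) * (b h * g h) ^ n) /
        (∏ a ∈ (Finset.range (2 * i + 1)).erase h, (b h * g h - b a * g a)) := by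
    rw [evenSum, Finset.mul_sum]
    refine Finset.sum_congr rfl fun h _ => ?_
    have hz := H.ne_zero h
    rw [sum_nested_even hz g b (by omega), weight]
    generalize b h * g h = z at *
    rw [pow_succ, two_mul, pow_add]
    field_simp
    ring
  rw [key, ← h, mul_zero]

end Normalization

/-! ### Identification of the closed forms -/

/-- The restriction of a lattice function to the forward `m`-ray from `(l, m)`. -/
def ray (f : Lat) (l m : ℤ) : ℕ → ℂ := fun h => sh f h l m

theorem ray_zero (f : Lat) (l m : ℤ) : ray f l m 0 = f l m := by simp [ray, sh]

theorem shift_ray (f : Lat) (l m : ℤ) : shift (ray f l m) = ray f l (m + 1) := by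
  funext h
  simp only [shift, ray, sh]
  congr 1
  push_cast
  ring

section ClosedForms

variable (β γ : Lat) (i : ℕ) (l m : ℤ)

theorem solA₁_eq : solA₁ β γ i l m = altProd (ray β l m) (ray γ l m) (2 * i) := by
  induction i with
  | zero => simp [solA₁, altProd]
  | succ i ih =>
    rw [show 2 * (i + 1) = 2 * i + 1 + 1 by ring, altProd_succ, altProd_succ, ← ih]
    simp only [solA₁, Finset.prod_range_succ, ray]
    ring

theorem solB₁_eq : solB₁ β γ i l m = altProd (ray β l m) (ray γ l m) (2 * i + 1) := by
  induction i with
  | zero => simp [solB₁, altProd, ray_zero]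
  | succ i ih =>
    rw [show 2 * (i + 1) + 1 = 2 * i + 1 + 1 + 1 by ring, altProd_succ, altProd_succ, ← ih]
    simp only [solB₁, Finset.prod_range_succ, ray]
    ring

end ClosedForms

theorem ray_ne_zero {f : Lat} (hf : ∀ l m, f l m ≠ 0) (l m : ℤ) (h : ℕ) : ray f l m h ≠ 0 :=
  hf _ _

theorem prod_erase_sub_comm (p : ℕ → ℂ) (i : ℕ) {h : ℕ} (hh : h < 2 * i + 1) :
    ∏ a ∈ (Finset.range (2 * i + 1)).erase h, (p a - p h) =
      ∏ a ∈ (Finset.range (2 * i + 1)).erase h, (p h - p a) := by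
  simp_rw [← neg_sub (p h)]
  rw [Finset.prod_neg, Finset.card_erase_of_mem (Finset.mem_range.2 hh), Finset.card_range]
  -- The erased range has `2 * i` elements, so the signs cancel.
  simp

section ClosedForms

variable {β γ : Lat} (i j : ℕ) (l m : ℤ)

theorem bg_eq (h : ℕ) : bg β γ h l m = ray β l m h * ray γ l m h := rfl

theorem solU_eq {h : ℕ} (hh : h < 2 * i + 1) :
    solU β γ i h l m = bg β γ h l m ^ ((i : ℤ) - 1) *
      (altProd (ray β l m) (ray γ l m) (2 * i + 1) /
        ∏ a ∈ (Finset.range (2 * i + 1)).erase h, (bg β γ h l m - bg β γ a l m)) := by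
  rw [← prod_erase_sub_comm (fun a => bg β γ a l m) i hh, ← solB₁_eq]
  rfl

theorem solV_eq (h : ℕ) :
    solV β γ i h l m = bg β γ h l m ^ ((i : ℤ) - 1) *
      (altProd (ray β l m) (ray γ l m) (2 * i) /
        ∏ a ∈ (Finset.range (2 * i)).erase h, (bg β γ h l m - bg β γ a l m)) := by
  rw [← solA₁_eq]
  rfl

theorem solS₁_eq (hβ : ∀ l m, β l m ≠ 0) (hγ : ∀ l m, γ l m ≠ 0) :
    solS₁ β γ i j l m = evenSum (ray β l m) (ray γ l m) (2 * i + 1) j := by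
  rw [solS₁, evenSum]
  refine Finset.sum_congr rfl fun h hh => ?_
  have hz : bg β γ h l m ≠ 0 := mul_ne_zero (ray_ne_zero hβ l m h) (ray_ne_zero hγ l m h)
  have hs := sum_nested_even hz (ray γ l m) (ray β l m) (le_refl (2 * i + 1))
  simp only [sCoeff, xi, solU_eq i l m (Finset.mem_range.1 hh), weight, ← bg_eq]
  change -_ * _ * (∑ g ∈ Finset.range (i + 1),
    nested (ray γ l m) (ray β l m) (2 * i - 2 * g) (2 * i + 1) * _) / _ = _
  rw [hs, zpow_sub_one₀ hz, zpow_natCast, two_mul, pow_succ _ (i + i), pow_add]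
  generalize bg β γ h l m = z at *
  field_simp
  ring

theorem solT₁_eq (hβ : ∀ l m, β l m ≠ 0) (hγ : ∀ l m, γ l m ≠ 0) :
    solT₁ β γ i j l m = oddSum (ray β l m) (ray γ l m) (2 * i + 1) j := by
  rw [solT₁, oddSum]
  refine Finset.sum_congr rfl fun h hh => ?_
  have hz : bg β γ h l m ≠ 0 := mul_ne_zero (ray_ne_zero hβ l m h) (ray_ne_zero hγ l m h)
  have hs := sum_nested_odd hz (ray γ l m) (ray β l m) (show 2 * i + 1 ≤ 2 * (i + 1) by omega)
  rw [mul_comm, ← eq_div_iff hz] at hs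
  simp only [tCoeff, eta, solU_eq i l m (Finset.mem_range.1 hh), weight, ← bg_eq]
  -- Reading the length `2 * i + 1 - 2 * g` as `2 * (i + 1) - 1 - 2 * g` makes this the odd identity
  -- at `i + 1`.
  change _ * (∑ g ∈ Finset.range (i + 1),
    nested (ray γ l m) (ray β l m) (2 * (i + 1) - 1 - 2 * g) (2 * i + 1) * _) / _ = _
  rw [hs, zpow_sub_one₀ hz, zpow_natCast, two_mul, pow_succ _ (i + i), pow_add]
  generalize bg β γ h l m = z at *
  field_simp
  ring

theorem solQ₁_eq (hβ : ∀ l m, β l m ≠ 0) (hγ : ∀ l m, γ l m ≠ 0) :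
    solQ₁ β γ i j l m = evenSum (ray β l m) (ray γ l m) (2 * i) j := by
  rw [solQ₁, evenSum]
  refine Finset.sum_congr rfl fun h hh => ?_
  have hz : bg β γ h l m ≠ 0 := mul_ne_zero (ray_ne_zero hβ l m h) (ray_ne_zero hγ l m h)
  have hs := sum_nested_even hz (ray γ l m) (ray β l m) (show 2 * i ≤ 2 * i + 1 by omega)
  -- A pole `h < 2 * i` forces `i > 0`, so the subtraction is not truncated.
  have hi : 2 * i - 1 + 1 = 2 * i := by
    have := Finset.mem_range.1 hh
    omega
  simp only [qCoeff, eta, solV_eq i l m, weight, ← bg_eq, hi]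
  change -_ * (∑ g ∈ Finset.range (i + 1),
    nested (ray γ l m) (ray β l m) (2 * i - 2 * g) (2 * i) * _) / _ = _
  rw [hs, zpow_sub_one₀ hz, zpow_natCast, two_mul, pow_add]
  generalize bg β γ h l m = z at *
  field_simp
  ring

theorem solR₁_eq (hβ : ∀ l m, β l m ≠ 0) (hγ : ∀ l m, γ l m ≠ 0) :
    solR₁ β γ i j l m = oddSum (ray β l m) (ray γ l m) (2 * i) j := by
  rw [solR₁, oddSum]
  refine Finset.sum_congr rfl fun h hh => ?_
  have hz : bg β γ h l m ≠ 0 := mul_ne_zero (ray_ne_zero hβ l m h) (ray_ne_zero hγ l m h)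
  have hs := sum_nested_odd hz (ray γ l m) (ray β l m) (le_refl (2 * i))
  rw [mul_comm, ← eq_div_iff hz] at hs
  have hi : 2 * i - 1 + 1 = 2 * i := by
    have := Finset.mem_range.1 hh
    omega
  simp only [rCoeff, xi, solV_eq i l m, weight, ← bg_eq, hi]
  change _ * (∑ g ∈ Finset.range i,
    nested (ray γ l m) (ray β l m) (2 * i - 1 - 2 * g) (2 * i) * _) / _ = _
  rw [hs, zpow_sub_one₀ hz, zpow_natCast, two_mul, pow_add]
  generalize bg β γ h l m = z at *
  field_simp
  ring

theorem prod_ratio_eq :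
    (1 / β l m) * ∏ h ∈ Finset.range i, (sh γ (2 * h) l m * sh β (2 * h + 1) l m) /
        (sh γ (2 * h + 1) l m * sh β (2 * h + 2) l m) =
      altProd (ray β l m) (ray γ l m) (2 * i) / altProd (ray β l m) (ray γ l m) (2 * i + 1) := by
  rw [← solA₁_eq, ← solB₁_eq, solA₁, solB₁, Finset.prod_div_distrib, div_mul_div_comm, one_mul]

/-- The nested sum has one factor fewer than there are sites. Peeling two top sites adds just two
extremal alternating products, and these yield the two summands of the new term of `solP₁`. -/
theorem solP₁_succ_eq (hβ : ∀ l m, β l m ≠ 0) (hγ : ∀ l m, γ l m ≠ 0) :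
    solP₁ β γ (i + 1) l m = -(nested (ray γ l m) (ray β l m) (2 * i + 1) (2 * i + 2) /
      altProd (ray γ l m) (ray β l m) (2 * i + 2)) := by
  induction i with
  | zero =>
    have h1 := hγ l (m + 1)
    have h2 := hβ l m
    simp [solP₁, nested, altProd, Finset.sum_range_succ, sh, ray]
    field_simp
  | succ i ih =>
    have hc := altProd_ne_zero (ray_ne_zero hγ l m) (ray_ne_zero hβ l m) (2 * i + 2)
    have hG := ray_ne_zero hγ l m (2 * i + 3)
    have hB := ray_ne_zero hβ l m (2 * i + 2)
    have hsum : solP₁ β γ (i + 1 + 1) l m = solP₁ β γ (i + 1) l m -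
        (ray γ l m (2 * i + 2) / ray γ l m (2 * i + 3) + 1) *
          (altProd (ray β l m) (ray γ l m) (2 * i + 2) /
            altProd (ray β l m) (ray γ l m) (2 * i + 3)) := by
      have := prod_ratio_eq (β := β) (γ := γ) (i + 1) l m
      rw [solP₁, Finset.sum_range_succ, neg_add, ← sub_eq_add_neg, mul_assoc, this]
      rfl
    have hn : nested (ray γ l m) (ray β l m) (2 * i + 3) (2 * i + 4) =
        altProd (ray γ l m) (ray β l m) (2 * i + 3) + ray γ l m (2 * i + 3) *
          (altProd (ray β l m) (ray γ l m) (2 * i + 2) + ray β l m (2 * i + 2) *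
            nested (ray γ l m) (ray β l m) (2 * i + 1) (2 * i + 2)) := by
      rw [nested_succ_succ, nested_self, nested_succ_succ, nested_self]
    rw [hsum, ih, show 2 * (i + 1) + 1 = 2 * i + 3 by ring, show 2 * (i + 1) + 2 = 2 * i + 4 by ring,
      hn, altProd_succ _ _ (2 * i + 3), altProd_succ _ _ (2 * i + 2), altProd_succ _ _ (2 * i + 2)]
    generalize altProd (ray γ l m) (ray β l m) (2 * i + 2) = c at *
    field_simp
    ring

/-- Makes P the boundary member `j = i` of the family R, so that its recursion needs no separate
argument. -/
theorem solP₁_eq_oddSum (hβ : ∀ l m, β l m ≠ 0) (hγ : ∀ l m, γ l m ≠ 0) {N : ℕ}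
    (H : Admissible (ray β l m) (ray γ l m) N) (hi : 2 * i ≤ N + 1) :
    solP₁ β γ i l m = oddSum (ray β l m) (ray γ l m) (2 * i) i := by
  rcases Nat.eq_zero_or_pos i with rfl | h
  · simp [solP₁, oddSum]
  · rw [oddSum_two_mul_self H h hi]
    obtain ⟨i, rfl⟩ : ∃ i', i = i' + 1 := ⟨i - 1, by omega⟩
    rw [solP₁_succ_eq i l m hβ hγ]
    rfl

theorem solGamma₁_eq (hβ : ∀ l m, β l m ≠ 0) :
    solGamma₁ β γ i l m =
      -(β (l + 1) m * β l m * ratio (ray β l m) (ray γ l m) (2 * i + 1)) := by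
  have h := hβ l m
  simp only [ratio, ← solB₁_eq γ β, show 2 * i + 1 + 1 = 2 * (i + 1) by ring, ← solA₁_eq γ β,
    solGamma₁, solB₁, solA₁, Finset.prod_div_distrib]
  rw [Finset.prod_range_succ' _ i]
  simp only [mul_add, add_assoc, mul_one, mul_zero, zero_add, Nat.reduceAdd]
  simp only [sh, Nat.cast_zero, add_zero, Nat.cast_one]
  field_simp

theorem solLambda₁_eq (hγ : ∀ l m, γ l m ≠ 0) :
    solLambda₁ β γ i l m =
      -(β (l + 1) m * γ l m * ratio (ray β l m) (ray γ l m) (2 * i)) := by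
  have h := hγ l m
  simp only [ratio, ← solB₁_eq γ β, ← solA₁_eq γ β, solLambda₁, solB₁, solA₁,
    Finset.prod_div_distrib]
  field_simp

end ClosedForms

/-! ### Scalar form of the recursion relations -/

/-- The scalar relations between two consecutive levels.  Primes stand for the shifted lower level,
`e o` for the upper level, `et ot` for the upper level with `β` and `γ` interchanged, and `en on`
for the lower level with `β` and `γ` interchanged. -/
structure LevelRelations (b g κ μ : ℂ) (e' o' e o et ot en on : ℕ → ℂ) : Prop where
  odd_eq : ∀ j, b * o j = κ * e' j - e j
  even_eq : ∀ j, g * e (j + 1) = κ * o' j - o j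
  even_swap : ∀ j, μ * et j = o j - en j
  odd_swap : ∀ j, μ * ot j = e (j + 1) - on j

theorem levelRelations {b g : ℕ → ℂ} {N : ℕ} (H : Admissible b g N) :
    LevelRelations (b 0) (g 0) (firstFactor b g N) (ratio b g N)
      (evenSum (shift b) (shift g) N) (oddSum (shift b) (shift g) N)
      (evenSum b g (N + 1)) (oddSum b g (N + 1)) (evenSum g b (N + 1)) (oddSum g b (N + 1))
      (evenSum g b N) (oddSum g b N) :=
  ⟨left_mul_oddSum_succ H, right_mul_evenSum_succ H, ratio_mul_evenSum_succ H,
    ratio_mul_oddSum_succ H⟩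

section Rows

variable {b g p μ : ℂ} {e' o' e o et ot en on : ℕ → ℂ} {i : ℕ}

theorem zpow_succ_sub (hp : p ≠ 0) (j i : ℕ) :
    p ^ (((j + 1 : ℕ) : ℤ) - (i : ℤ)) = p * p ^ ((j : ℤ) - (i : ℤ)) := by
  rw [← zpow_one_add₀ hp]
  congr 1
  push_cast
  ring

theorem zpow_succ_sub_self (p : ℂ) (j : ℕ) : p ^ (((j + 1 : ℕ) : ℤ) - (j : ℤ)) = p := by
  rw [show (((j + 1 : ℕ) : ℤ) - (j : ℤ)) = 1 by push_cast; ring, zpow_one]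

theorem one_div_zpow_succ_sub (hp : p ≠ 0) (j i : ℕ) :
    1 / p ^ (((j + 1 : ℕ) : ℤ) - (i : ℤ)) = 1 / p ^ ((j : ℤ) - (i : ℤ)) / p := by
  rw [zpow_succ_sub hp, div_div, mul_comm]

theorem sum_Ico_succ_zpow (hp : p ≠ 0) (f : ℕ → ℂ) {j : ℕ} (hj : i + 1 ≤ j) :
    ∑ h ∈ Finset.Ico (i + 1) (j + 1), f h * (1 / p ^ (((j + 1 : ℕ) : ℤ) - (h : ℤ))) =
      ((∑ h ∈ Finset.Ico (i + 1) j, f h * (1 / p ^ ((j : ℤ) - (h : ℤ)))) + f j) / p := by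
  rw [Finset.sum_Ico_succ_top hj, zpow_succ_sub_self, add_div, Finset.sum_div]
  congr 1
  · refine Finset.sum_congr rfl fun h _ => ?_
    rw [zpow_succ_sub hp]
    field_simp
  · ring

/-- Eliminating `o j` gives `e j - p * e (j + 1) = g * (e' j - b * o' j)`; weighted by powers of `p`
this telescopes from `e (i + 1) = 1`. -/
theorem LevelRelations.sum_eq_of_right (R : LevelRelations b g g μ e' o' e o et ot en on)
    (hb : b ≠ 0) (hg : g ≠ 0) (hp : p = b * g) (he : e (i + 1) = 1) {j : ℕ} (hj : i + 1 ≤ j) :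
    g * ∑ h ∈ Finset.Ico (i + 1) j, (e' h - b * o' h) * (1 / p ^ ((j : ℤ) - (h : ℤ))) =
      p * (1 / p ^ ((j : ℤ) - (i : ℤ))) - e j := by
  have hp0 : p ≠ 0 := hp ▸ mul_ne_zero hb hg
  induction j, hj using Nat.le_induction with
  | base =>
    rw [Finset.Ico_self, Finset.sum_empty, zpow_succ_sub_self, he]
    field_simp
    simp
  | succ j hj ih =>
    have h1 := R.odd_eq j
    have h2 := R.even_eq j
    rw [sum_Ico_succ_zpow hp0 _ hj, one_div_zpow_succ_sub hp0, mul_div_assoc', mul_add, ih]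
    generalize 1 / p ^ ((j : ℤ) - (i : ℤ)) = W
    field_simp
    linear_combination -h1 + b * h2 + e (j + 1) * hp

/-- The same telescoping with `b` for `g` on the right. Here the starting value comes from `o i =
1`, through `even_eq` at `i`, which accounts for the boundary term `1 - b * o' i`. -/
theorem LevelRelations.sum_eq_of_left (R : LevelRelations b g b μ e' o' e o et ot en on)
    (hb : b ≠ 0) (hg : g ≠ 0) (hp : p = b * g) (ho : o i = 1) {j : ℕ} (hj : i + 1 ≤ j) :
    e j = -b * ((∑ h ∈ Finset.Ico (i + 1) j, (e' h - b * o' h) * (1 / p ^ ((j : ℤ) - (h : ℤ)))) +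
      (1 - b * o' i) * (1 / p ^ ((j : ℤ) - (i : ℤ)))) := by
  have hp0 : p ≠ 0 := hp ▸ mul_ne_zero hb hg
  induction j, hj using Nat.le_induction with
  | base =>
    rw [Finset.Ico_self, Finset.sum_empty, zpow_succ_sub_self]
    field_simp
    have h2 := R.even_eq i
    linear_combination b * h2 - b * ho + e (i + 1) * hp
  | succ j hj ih =>
    have h1 := R.odd_eq j
    have h2 := R.even_eq j
    rw [sum_Ico_succ_zpow hp0 _ hj, one_div_zpow_succ_sub hp0]
    generalize 1 / p ^ ((j : ℤ) - (i : ℤ)) = W at *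
    generalize ∑ h ∈ Finset.Ico (i + 1) j, (e' h - b * o' h) * (1 / p ^ ((j : ℤ) - (h : ℤ))) = X at *
    field_simp
    linear_combination ih - h1 + b * h2 + e (j + 1) * hp

/-- The entries of the first row of the first set of recursion relations. -/
theorem LevelRelations.row_of_right (R : LevelRelations b g g μ e' o' e o et ot en on)
    (hb : b ≠ 0) (hg : g ≠ 0) (hp : p = b * g) (he : e (i + 1) = 1) {j : ℕ} (hj : i + 1 ≤ j)
    {W X : ℂ} (hW : W = 1 / p ^ ((j : ℤ) - (i : ℤ)))
    (hX : X = ∑ h ∈ Finset.Ico (i + 1) j, (e' h - b * o' h) * (1 / p ^ ((j : ℤ) - (h : ℤ)))) :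
    1 / g * e j = b * W - X ∧
    μ / g * et j = e' j / b - en j / g - W + X / b ∧
    1 / g * o j = e' j / b - W + X / b ∧
    μ / g * ot j = -(e' j / p) + o' j / g - on j / g + W / g - X / p := by
  have h := R.sum_eq_of_right hb hg hp he hj
  rw [← hX, ← hW] at h
  have h1 := R.odd_eq j
  have h2 := R.even_eq j
  have h3 := R.even_swap j
  have h4 := R.odd_swap j
  have c1 : 1 / g * e j = b * W - X := by
    field_simp
    linear_combination h + W * hp
  have c3 : 1 / g * o j = e' j / b - W + X / b := by
    field_simp at c1 ⊢
    linear_combination h1 - c1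
  refine ⟨c1, ?_, c3, ?_⟩
  · have : μ / g * et j = 1 / g * o j - en j / g := by linear_combination h3 / g
    rw [this, c3]
    ring
  · have : μ / g * ot j = (g * e (j + 1) - g * on j) / g ^ 2 := by
      field_simp
      linear_combination h4
    rw [this, h2]
    subst hp
    field_simp at c3 ⊢
    linear_combination -c3

/-- The entries of the first row of the second set of recursion relations. -/
theorem LevelRelations.row_of_left (R : LevelRelations b g b μ e' o' e o et ot en on)
    (hb : b ≠ 0) (hg : g ≠ 0) (hp : p = b * g) (ho : o i = 1) {j : ℕ} (hj : i + 1 ≤ j)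
    {W X : ℂ} (hW : W = 1 / p ^ ((j : ℤ) - (i : ℤ)))
    (hX : X = ∑ h ∈ Finset.Ico (i + 1) j, (e' h - b * o' h) * (1 / p ^ ((j : ℤ) - (h : ℤ)))) :
    1 / b * e j = o' i * (b * W) - W - X ∧
    μ / b * et j = -(o' i * W) + e' j / b - en j / b + W / b + X / b ∧
    1 / b * o j = e' j / b - o' i * W + W / b + X / b ∧
    μ / b * ot j = -(e' j / p) + o' j / g - on j / b + o' i * W / g - W / p - X / p := by
  have h := R.sum_eq_of_left hb hg hp ho hj
  rw [← hX, ← hW] at h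
  have h1 := R.odd_eq j
  have h2 := R.even_eq j
  have h3 := R.even_swap j
  have h4 := R.odd_swap j
  have c1 : 1 / b * e j = b * o' i * W - W - X := by
    field_simp
    linear_combination h
  have c3 : 1 / b * o j = e' j / b - o' i * W + W / b + X / b := by
    have : o j = e' j - 1 / b * e j := by
      field_simp
      linear_combination h1
    rw [this, c1]
    field_simp
    ring
  refine ⟨by rw [c1]; ring, ?_, c3, ?_⟩
  · have : μ / b * et j = 1 / b * o j - en j / b := by linear_combination h3 / b
    rw [this, c3]
    ring
  · have : μ / b * ot j = (g * e (j + 1) - g * on j) / (b * g) := by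
      field_simp
      linear_combination h4
    rw [this, h2]
    subst hp
    field_simp at c3 ⊢
    linear_combination -c3

/-- The off-diagonal entry of the matrix inverted by the first set of recursion relations. -/
theorem LevelRelations.offDiag_of_right (R : LevelRelations b g g μ e' o' e o et ot en on)
    (hb : b ≠ 0) (hg : g ≠ 0) (hp : p = b * g) (he : e (i + 1) = 1) (het : et (i + 1) = 1) :
    e' (i + 1) / b - en (i + 1) / g - 1 / p = μ / g := by
  have h1 := R.odd_eq (i + 1)
  have h3 := R.even_swap (i + 1)
  rw [het] at h3
  rw [he] at h1
  subst hp
  field_simp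
  linear_combination -h1 - b * h3

/-- The off-diagonal entry of the matrix inverted by the second set of recursion relations. -/
theorem LevelRelations.offDiag_of_left (R : LevelRelations b g b μ e' o' e o et ot en on)
    (hb : b ≠ 0) (hg : g ≠ 0) (hp : p = b * g) (ho : o i = 1) (hot : ot i = 1) :
    o' i / g - on i / b - 1 / p = μ / b := by
  have h2 := R.even_eq i
  have h4 := R.odd_swap i
  rw [hot] at h4
  rw [ho] at h2
  subst hp
  field_simp
  linear_combination -h2 - g * h4

end Rows

/-! ### Matrix form of the recursion relations -/

section MatrixForm

variable {β γ : Lat} {l m : ℤ}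

theorem sum_diag_mul_D_add_F (hb : β l m ≠ 0) (hg : γ l m ≠ 0) (s : Finset ℕ) (j : ℕ)
    (a a' c c' : ℕ → ℂ) {X X' : ℂ}
    (hX : X = ∑ h ∈ s, (a h - β l m * c h) * (1 / (β l m * γ l m) ^ ((j : ℤ) - (h : ℤ))))
    (hX' : X' = ∑ h ∈ s, (a' h - γ l m * c' h) * (1 / (β l m * γ l m) ^ ((j : ℤ) - (h : ℤ)))) :
    ∑ h ∈ s, (!![a h, 0; 0, a' h] * D β γ h j l m + !![c h, 0; 0, c' h] * F β γ h j l m) =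
      !![-X, β (l + 1) m / β l m * X; γ (l + 1) m / γ l m * X', -X'] := by
  subst hX hX'
  ext r t
  rw [Matrix.sum_apply]
  fin_cases r <;> fin_cases t <;>
    simp only [D, F, Matrix.mul_smul, Matrix.mul_fin_two, Matrix.add_apply, Matrix.smul_apply,
      Matrix.of_apply, Matrix.cons_val', Matrix.cons_val_zero, Matrix.cons_val_one,
      Matrix.cons_val_fin_one, Fin.zero_eta, Fin.mk_one, Fin.isValue, smul_eq_mul,
      Finset.mul_sum, ← Finset.sum_neg_distrib] <;>
    refine Finset.sum_congr rfl fun h _ => ?_ <;>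
    generalize 1 / (β l m * γ l m) ^ ((j : ℤ) - (h : ℤ)) = W <;>
    field_simp <;> ring

theorem sum_diag_mul_E_add_G (hb : β l m ≠ 0) (hg : γ l m ≠ 0) (s : Finset ℕ) (j : ℕ)
    (a a' c c' : ℕ → ℂ) {X X' : ℂ}
    (hX : X = ∑ h ∈ s, (a h - β l m * c h) * (1 / (β l m * γ l m) ^ ((j : ℤ) - (h : ℤ))))
    (hX' : X' = ∑ h ∈ s, (a' h - γ l m * c' h) * (1 / (β l m * γ l m) ^ ((j : ℤ) - (h : ℤ)))) :
    ∑ h ∈ s, (!![a h, 0; 0, a' h] * E β γ h j l m + !![c h, 0; 0, c' h] * G β γ h j l m) =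
      !![X / β l m, -(β (l + 1) m / (β l m * γ l m) * X);
         -(γ (l + 1) m / (β l m * γ l m) * X'), X' / γ l m] := by
  subst hX hX'
  ext r t
  rw [Matrix.sum_apply]
  fin_cases r <;> fin_cases t <;>
    simp only [E, G, Matrix.mul_smul, Matrix.mul_fin_two, Matrix.add_apply, Matrix.smul_apply,
      Matrix.of_apply, Matrix.cons_val', Matrix.cons_val_zero, Matrix.cons_val_one,
      Matrix.cons_val_fin_one, Fin.zero_eta, Fin.mk_one, Fin.isValue, smul_eq_mul,
      Finset.mul_sum, Finset.sum_div, ← Finset.sum_neg_distrib] <;>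
    refine Finset.sum_congr rfl fun h _ => ?_ <;>
    generalize 1 / (β l m * γ l m) ^ ((j : ℤ) - (h : ℤ)) = W <;>
    field_simp <;> ring

theorem isUnit_and_inv_eq {M M' : Matrix (Fin 2) (Fin 2) ℂ} (h : M * M' = 1) :
    IsUnit M ∧ M⁻¹ = M' :=
  ⟨(Matrix.isUnit_iff_isUnit_det _).2 (Matrix.isUnit_det_of_right_inverse h),
    Matrix.inv_eq_right_inv h⟩

theorem eq_inv_mul_of_mul_eq {M X Y : Matrix (Fin 2) (Fin 2) ℂ} (hM : IsUnit M)
    (h : M * X = Y) : X = M⁻¹ * Y := by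
  rw [← h, Matrix.nonsing_inv_mul_cancel_left _ _ ((Matrix.isUnit_iff_isUnit_det _).1 hM)]

theorem eq_inv_mulVec_of_mulVec_eq {M : Matrix (Fin 2) (Fin 2) ℂ} {X Y : Fin 2 → ℂ}
    (hM : IsUnit M) (h : M *ᵥ X = Y) : X = M⁻¹ *ᵥ Y := by
  rw [← h, Matrix.mulVec_mulVec,
    Matrix.nonsing_inv_mul _ ((Matrix.isUnit_iff_isUnit_det _).1 hM), Matrix.one_mulVec]

/-- The inverse of a matrix of the shape of the ones inverted in the recursion relations. -/
theorem mul_inverse_form {a d x y σ σ' q : ℂ} (ha : a ≠ 0) (hd : d ≠ 0) (hq : q ≠ 0)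
    (hσ : σ * σ' * (a * d) = 1 / q) (hxy : x * y ≠ q) :
    !![1 / a, x * σ; y * σ', 1 / d] *
      ((1 / (1 - x * y / q)) • !![a, -(x * σ * (a * d)); -(y * σ' * (a * d)), d]) = 1 := by
  have h1 : 1 - x * y / q ≠ 0 := by
    intro h
    apply hxy
    field_simp at h
    linear_combination -h
  have h2 : !![1 / a, x * σ; y * σ', 1 / d] * !![a, -(x * σ * (a * d)); -(y * σ' * (a * d)), d] =
      (1 - x * y / q) • (1 : Matrix (Fin 2) (Fin 2) ℂ) := by
    rw [div_eq_mul_one_div (x * y), ← hσ, Matrix.mul_fin_two, Matrix.one_fin_two]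
    ext r t
    fin_cases r <;> fin_cases t <;> simp <;> field_simp <;> ring
  rw [Matrix.mul_smul, h2, smul_smul, one_div_mul_cancel h1, one_smul]

section Recursion

variable {u : Unknowns} {i : ℕ} {μ μ' : ℂ} {e' o' e o et ot en on et' ot' en' on' : ℕ → ℂ}

theorem recursionOne_of_levelRelations (hb : β l m ≠ 0) (hg : γ l m ≠ 0)
    (R : LevelRelations (β l m) (γ l m) (γ l m) μ e' o' e o et ot en on)
    (R' : LevelRelations (γ l m) (β l m) (β l m) μ' et' ot' et ot e o en' on')
    (he : e (i + 1) = 1) (het : et (i + 1) = 1)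
    (hS : ∀ j, u.S i j l m = !![en' j, 0; 0, en j])
    (hS' : ∀ j, u.S i j l (m + 1) = !![e' j, 0; 0, et' j])
    (hT : ∀ j, u.T i j l m = !![on' j, 0; 0, on j])
    (hT' : ∀ j, u.T i j l (m + 1) = !![o' j, 0; 0, ot' j])
    (hQ : ∀ j, u.Q (i + 1) j l m = !![e j, 0; 0, et j])
    (hR : ∀ j, u.R (i + 1) j l m = !![o j, 0; 0, ot j])
    (hP : u.P (i + 1) l m = !![o (i + 1), 0; 0, ot (i + 1)])
    {A A' B B' C C' : ℂ} (hA : u.A (i + 1) l m = ![A, A']) (hB : u.B i l m = ![B, B'])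
    (hB' : u.B i l (m + 1) = ![C, C']) (hAC : A = γ l m * C) (hAC' : A' = β l m * C')
    (hAB : μ * A' = -B') (hAB' : μ' * A = -B)
    {q : ℂ} (hq : q ≠ 0) (hμ : μ * μ' = 1 / q) (hxy : β (l + 1) m * γ (l + 1) m ≠ q)
    {Γ₁ Γ₂ : ℂ} (hΓ₁ : Γ₁ = -(β (l + 1) m * β l m * μ)) (hΓ₂ : Γ₂ = -(γ (l + 1) m * γ l m * μ')) :
    RecursionOne β γ u i l m ∧
      gammaMat β γ u i l m = (1 / (1 - β (l + 1) m * γ (l + 1) m / q)) •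
        !![γ l m, Γ₁; Γ₂, β l m] := by
  have hp : β l m * γ l m = γ l m * β l m := mul_comm _ _
  have hden : gammaDen β γ u i l m = !![1 / γ l m, β (l + 1) m * (μ / γ l m);
      γ (l + 1) m * (μ' / β l m), 1 / β l m] := by
    rw [← R.offDiag_of_right hb hg rfl he het, ← R'.offDiag_of_right hg hb hp het he]
    simp only [gammaDen, hS, hS', K, J, F, zpow_succ_sub_self]
    ext r t
    fin_cases r <;> fin_cases t <;> simp <;> field_simp <;> ring
  obtain ⟨hu, hinv⟩ := isUnit_and_inv_eq (mul_inverse_form (x := β (l + 1) m)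
    (y := γ (l + 1) m) (σ := μ / γ l m) (σ' := μ' / β l m) hg hb hq
    (by rw [← hμ]; field_simp) hxy)
  rw [← hden] at hu hinv
  -- Both matrix relations with the inverse cleared. The case `j = i + 1` is included because there
  -- the R relation, with empty sum, is the one for P.
  have hrow : ∀ j, i + 1 ≤ j →
      gammaDen β γ u i l m * !![e j, 0; 0, et j] =
        u.S i j l (m + 1) * K β γ l m - J β γ l m * u.S i j l m + F β γ i j l m
        + ∑ h ∈ Finset.Ico (i + 1) j,
            (u.S i h l (m + 1) * D β γ h j l m + u.T i h l (m + 1) * F β γ h j l m) ∧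
      gammaDen β γ u i l m * !![o j, 0; 0, ot j] =
        u.S i j l (m + 1) * H β γ l m + u.T i j l (m + 1) * J β γ l m
        - J β γ l m * u.T i j l m + G β γ i j l m
        + ∑ h ∈ Finset.Ico (i + 1) j,
            (u.S i h l (m + 1) * E β γ h j l m + u.T i h l (m + 1) * G β γ h j l m) := by
    intro j hj
    obtain ⟨a1, a2, a3, a4⟩ := R.row_of_right hb hg rfl he hj rfl rfl
    obtain ⟨b1, b2, b3, b4⟩ := R'.row_of_right hg hb hp het hj rfl rfl
    simp only [hS, hS', hT, hT']
    rw [sum_diag_mul_D_add_F hb hg _ j e' et' o' ot' rfl rfl,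
      sum_diag_mul_E_add_G hb hg _ j e' et' o' ot' rfl rfl, hden]
    simp only [K, J, F, H, G]
    generalize ∑ h ∈ Finset.Ico (i + 1) j, (e' h - β l m * o' h) * _ = X at *
    generalize ∑ h ∈ Finset.Ico (i + 1) j, (et' h - γ l m * ot' h) * _ = X' at *
    generalize 1 / (β l m * γ l m) ^ ((j : ℤ) - (i : ℤ)) = W at *
    constructor
    · ext r t
      fin_cases r <;> fin_cases t <;> simp
      · linear_combination a1
      · linear_combination β (l + 1) m * a2
      · linear_combination γ (l + 1) m * b2
      · linear_combination b1
    · ext r t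
      fin_cases r <;> fin_cases t <;> simp
      · linear_combination a3
      · linear_combination β (l + 1) m * a4
      · linear_combination γ (l + 1) m * b4
      · linear_combination b3
  refine ⟨⟨hu, ?_, ?_, ?_, ?_⟩, ?_⟩
  · apply eq_inv_mulVec_of_mulVec_eq hu
    rw [hden, hA, hB, hB', J]
    ext r
    fin_cases r <;> simp [Matrix.mulVec, dotProduct, Fin.sum_univ_two]
    · rw [hAC]
      field_simp
      linear_combination β (l + 1) m * hAB
    · rw [hAC']
      field_simp
      linear_combination γ (l + 1) m * hAB'
  · apply eq_inv_mul_of_mul_eq hu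
    rw [hP, (hrow (i + 1) le_rfl).2, Finset.Ico_self, Finset.sum_empty, add_zero]
  · intro j hj
    apply eq_inv_mul_of_mul_eq hu
    rw [hQ, (hrow j hj.le).1]
  · intro j hj
    apply eq_inv_mul_of_mul_eq hu
    rw [hR, (hrow j hj.le).2]
  · rw [gammaMat, hinv, hΓ₁, hΓ₂]
    congr 1
    ext r t
    fin_cases r <;> fin_cases t <;> simp <;> field_simp

theorem recursionTwo_of_levelRelations (hb : β l m ≠ 0) (hg : γ l m ≠ 0)
    (R : LevelRelations (β l m) (γ l m) (β l m) μ e' o' e o et ot en on)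
    (R' : LevelRelations (γ l m) (β l m) (γ l m) μ' et' ot' et ot e o en' on')
    (ho : o i = 1) (hot : ot i = 1)
    (hQ : ∀ j, u.Q i j l m = !![en' j, 0; 0, en j])
    (hQ' : ∀ j, u.Q i j l (m + 1) = !![e' j, 0; 0, et' j])
    (hR : ∀ j, u.R i j l m = !![on' j, 0; 0, on j])
    (hR' : ∀ j, u.R i j l (m + 1) = !![o' j, 0; 0, ot' j])
    (hS : ∀ j, u.S i j l m = !![e j, 0; 0, et j])
    (hT : ∀ j, u.T i j l m = !![o j, 0; 0, ot j])
    (hP : u.P i l m = !![on' i, 0; 0, on i])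
    (hP' : u.P i l (m + 1) = !![o' i, 0; 0, ot' i])
    {A A' B B' C C' : ℂ} (hA : u.A i l m = ![A, A']) (hB : u.B i l m = ![B, B'])
    (hA' : u.A i l (m + 1) = ![C, C']) (hBC : B = β l m * C) (hBC' : B' = γ l m * C')
    (hBA : μ * B' = -A') (hBA' : μ' * B = -A)
    {q : ℂ} (hq : q ≠ 0) (hμ : μ * μ' = 1 / q) (hxy : β (l + 1) m * γ (l + 1) m ≠ q)
    {Λ₁ Λ₂ : ℂ} (hΛ₁ : Λ₁ = -(β (l + 1) m * γ l m * μ)) (hΛ₂ : Λ₂ = -(γ (l + 1) m * β l m * μ')) :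
    RecursionTwo β γ u i l m ∧
      lambdaMat β γ u i l m = (1 / (1 - β (l + 1) m * γ (l + 1) m / q)) •
        !![β l m, Λ₁; Λ₂, γ l m] := by
  have hp : β l m * γ l m = γ l m * β l m := mul_comm _ _
  have hden : lambdaDen β γ u i l m = !![1 / β l m, β (l + 1) m * (μ / β l m);
      γ (l + 1) m * (μ' / γ l m), 1 / γ l m] := by
    rw [← R.offDiag_of_left hb hg rfl ho hot, ← R'.offDiag_of_left hg hb hp hot ho]
    simp only [lambdaDen, hP, hP', K, J, H]
    ext r t
    fin_cases r <;> fin_cases t <;> simp <;> field_simp <;> ring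
  obtain ⟨hu, hinv⟩ := isUnit_and_inv_eq (mul_inverse_form (x := β (l + 1) m)
    (y := γ (l + 1) m) (σ := μ / β l m) (σ' := μ' / γ l m) hb hg hq
    (by rw [← hμ]; field_simp) hxy)
  rw [← hden] at hu hinv
  have hrow : ∀ j, i + 1 ≤ j →
      lambdaDen β γ u i l m * !![e j, 0; 0, et j] =
        u.P i l (m + 1) * F β γ i j l m + u.Q i j l (m + 1) * K β γ l m
        - K β γ l m * u.Q i j l m + D β γ i j l m
        + ∑ h ∈ Finset.Ico (i + 1) j,
            (u.Q i h l (m + 1) * D β γ h j l m + u.R i h l (m + 1) * F β γ h j l m) ∧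
      lambdaDen β γ u i l m * !![o j, 0; 0, ot j] =
        u.Q i j l (m + 1) * H β γ l m + u.R i j l (m + 1) * J β γ l m
        - K β γ l m * u.R i j l m + u.P i l (m + 1) * G β γ i j l m + E β γ i j l m
        + ∑ h ∈ Finset.Ico (i + 1) j,
            (u.Q i h l (m + 1) * E β γ h j l m + u.R i h l (m + 1) * G β γ h j l m) := by
    intro j hj
    obtain ⟨a1, a2, a3, a4⟩ := R.row_of_left hb hg rfl ho hj rfl rfl
    obtain ⟨b1, b2, b3, b4⟩ := R'.row_of_left hg hb hp hot hj rfl rfl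
    simp only [hP', hQ, hQ', hR, hR']
    rw [sum_diag_mul_D_add_F hb hg _ j e' et' o' ot' rfl rfl,
      sum_diag_mul_E_add_G hb hg _ j e' et' o' ot' rfl rfl, hden]
    simp only [K, J, F, H, G, D, E]
    generalize ∑ h ∈ Finset.Ico (i + 1) j, (e' h - β l m * o' h) * _ = X at *
    generalize ∑ h ∈ Finset.Ico (i + 1) j, (et' h - γ l m * ot' h) * _ = X' at *
    generalize 1 / (β l m * γ l m) ^ ((j : ℤ) - (i : ℤ)) = W at *
    constructor
    · ext r t
      fin_cases r <;> fin_cases t <;> simp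
      · linear_combination a1
      · linear_combination β (l + 1) m * a2
      · linear_combination γ (l + 1) m * b2
      · linear_combination b1
    · ext r t
      fin_cases r <;> fin_cases t <;> simp
      · linear_combination a3
      · linear_combination β (l + 1) m * a4
      · linear_combination γ (l + 1) m * b4
      · linear_combination b3
  refine ⟨⟨hu, ?_, ?_, ?_⟩, ?_⟩
  · apply eq_inv_mulVec_of_mulVec_eq hu
    rw [hden, hA, hB, hA', K]
    ext r
    fin_cases r <;> simp [Matrix.mulVec, dotProduct, Fin.sum_univ_two]
    · rw [hBC]
      field_simp
      linear_combination β (l + 1) m * hBA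
    · rw [hBC']
      field_simp
      linear_combination γ (l + 1) m * hBA'
  · intro j hj
    apply eq_inv_mul_of_mul_eq hu
    rw [hS, (hrow j hj).1]
  · intro j hj
    apply eq_inv_mul_of_mul_eq hu
    rw [hT, (hrow j hj).2]
  · rw [lambdaMat, hinv, hΛ₁, hΛ₂]
    congr 1
    ext r t
    fin_cases r <;> fin_cases t <;> simp <;> field_simp

end Recursion

end MatrixForm

/-! ### The closed forms solve the recursion relations -/

section Solution

variable {β γ : Lat} {k i : ℕ} {l m : ℤ}

/-- The hypothesis compares each shift only with the base point; moving the base point along m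
separates every pair of poles. -/
theorem admissible_ray (hβ : ∀ l m, β l m ≠ 0) (hγ : ∀ l m, γ l m ≠ 0)
    (hdist : ∀ l m : ℤ, ∀ h : ℕ, 1 ≤ h → h ≤ 2 * k →
      β l (m + h) * γ l (m + h) ≠ β l m * γ l m) (l m : ℤ) :
    Admissible (ray β l m) (ray γ l m) (2 * k) := by
  refine ⟨ray_ne_zero hβ l m, ray_ne_zero hγ l m, ?_⟩
  have key : ∀ h ≤ 2 * k, ∀ a < h,
      ray β l m h * ray γ l m h ≠ ray β l m a * ray γ l m a := by
    intro h hh a ha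
    have := hdist l (m + a) (h - a) (by omega) (by omega)
    rw [Nat.cast_sub ha.le, show m + (a : ℤ) + ((h : ℤ) - a) = m + h by ring] at this
    exact this
  intro h hh a ha hne
  rcases lt_or_gt_of_ne hne with hlt | hlt
  · exact key h hh a hlt
  · exact (key a ha h hlt).symm

theorem Admissible.mono {b g : ℕ → ℂ} {N M : ℕ} (H : Admissible b g N) (h : M ≤ N) :
    Admissible b g M :=
  ⟨H.left, H.right, fun x hx y hy => H.distinct x (hx.trans h) y (hy.trans h)⟩

theorem firstFactor_even (u v : ℕ → ℂ) (i : ℕ) : firstFactor u v (2 * i) = u 0 := by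
  simp [firstFactor]

theorem firstFactor_odd (u v : ℕ → ℂ) (i : ℕ) : firstFactor u v (2 * i + 1) = v 0 := by
  simp [firstFactor]

theorem ratio_mul_altProd {b g : ℕ → ℂ} {N : ℕ} (H : Admissible b g N) :
    ratio b g N * altProd g b (N + 1) = -altProd g b N := by
  have := altProd_ne_zero H.right H.left (N + 1)
  rw [ratio]
  field_simp

/-- For `i > 0` the bottom-site relation expresses this sum through two known values, 1 for the
shifted even sum and 0 for the unshifted one. Both values fail at `i = 0`, where the single pole is
computed directly. -/
theorem oddSum_two_mul_add_one_self {b g : ℕ → ℂ} {N : ℕ} (H : Admissible b g (2 * i))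
    (H' : Admissible (shift b) (shift g) N) (hN : 2 * i ≤ N + 1) :
    oddSum b g (2 * i + 1) i = 1 := by
  rcases Nat.eq_zero_or_pos i with rfl | hi
  · have h1 := H.left 0
    have h2 := H.right 0
    simp [oddSum, weight, altProd, transfer]
    field_simp
  · have h := left_mul_oddSum_succ H i
    rw [firstFactor_even, evenSum_two_mul_self H' hi hN,
      evenSum_two_mul_add_one_self H hi le_rfl, sub_zero] at h
    exact mul_left_cancel₀ (H.left 0) h

theorem solution_S (hβ : ∀ l m, β l m ≠ 0) (hγ : ∀ l m, γ l m ≠ 0) {N : ℕ} (hN : N = 2 * i + 1)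
    (j : ℕ) (l m : ℤ) : (solution β γ).S i j l m =
      !![evenSum (ray β l m) (ray γ l m) N j, 0; 0, evenSum (ray γ l m) (ray β l m) N j] := by
  rw [hN, ← solS₁_eq i j l m hβ hγ, ← solS₁_eq i j l m hγ hβ]
  rfl

theorem solution_T (hβ : ∀ l m, β l m ≠ 0) (hγ : ∀ l m, γ l m ≠ 0) {N : ℕ} (hN : N = 2 * i + 1)
    (j : ℕ) (l m : ℤ) : (solution β γ).T i j l m =
      !![oddSum (ray β l m) (ray γ l m) N j, 0; 0, oddSum (ray γ l m) (ray β l m) N j] := by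
  rw [hN, ← solT₁_eq i j l m hβ hγ, ← solT₁_eq i j l m hγ hβ]
  rfl

theorem solution_Q (hβ : ∀ l m, β l m ≠ 0) (hγ : ∀ l m, γ l m ≠ 0) {N : ℕ} (hN : N = 2 * i)
    (j : ℕ) (l m : ℤ) : (solution β γ).Q i j l m =
      !![evenSum (ray β l m) (ray γ l m) N j, 0; 0, evenSum (ray γ l m) (ray β l m) N j] := by
  rw [hN, ← solQ₁_eq i j l m hβ hγ, ← solQ₁_eq i j l m hγ hβ]
  rfl

theorem solution_R (hβ : ∀ l m, β l m ≠ 0) (hγ : ∀ l m, γ l m ≠ 0) {N : ℕ} (hN : N = 2 * i)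
    (j : ℕ) (l m : ℤ) : (solution β γ).R i j l m =
      !![oddSum (ray β l m) (ray γ l m) N j, 0; 0, oddSum (ray γ l m) (ray β l m) N j] := by
  rw [hN, ← solR₁_eq i j l m hβ hγ, ← solR₁_eq i j l m hγ hβ]
  rfl

theorem solution_P (hβ : ∀ l m, β l m ≠ 0) (hγ : ∀ l m, γ l m ≠ 0) {N M : ℕ} (hN : N = 2 * i)
    (H : Admissible (ray β l m) (ray γ l m) M) (hM : 2 * i ≤ M + 1) :
    (solution β γ).P i l m =
      !![oddSum (ray β l m) (ray γ l m) N i, 0; 0, oddSum (ray γ l m) (ray β l m) N i] := by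
  rw [hN, ← solP₁_eq_oddSum i l m hβ hγ H hM, ← solP₁_eq_oddSum i l m hγ hβ H.swap hM]
  rfl

theorem solution_A {N : ℕ} (hN : N = 2 * i) (l m : ℤ) : (solution β γ).A i l m =
    ![altProd (ray β l m) (ray γ l m) N, altProd (ray γ l m) (ray β l m) N] := by
  rw [hN, ← solA₁_eq, ← solA₁_eq]
  rfl

theorem solution_B {N : ℕ} (hN : N = 2 * i + 1) (l m : ℤ) : (solution β γ).B i l m =
    ![altProd (ray β l m) (ray γ l m) N, altProd (ray γ l m) (ray β l m) N] := by
  rw [hN, ← solB₁_eq, ← solB₁_eq]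
  rfl

theorem recursionOne_solution (hβ : ∀ l m, β l m ≠ 0) (hγ : ∀ l m, γ l m ≠ 0)
    (hadm : ∀ l m, Admissible (ray β l m) (ray γ l m) (2 * k))
    (hbar : ∀ l m : ℤ, ∀ n : ℕ, n ≤ 2 * k →
      β (l + 1) m * γ (l + 1) m ≠ β l (m + n) * γ l (m + n)) (hi : i < k) :
    RecursionOne β γ (solution β γ) i l m ∧
      gammaMat β γ (solution β γ) i l m = solGamma β γ i l m := by
  have H : Admissible (ray β l m) (ray γ l m) (2 * i + 1) := (hadm l m).mono (by omega)
  have R := levelRelations H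
  have R' := levelRelations H.swap
  rw [firstFactor_odd, shift_ray, shift_ray, ray_zero, ray_zero] at R R'
  have he : evenSum (ray β l m) (ray γ l m) (2 * i + 1 + 1) (i + 1) = 1 :=
    evenSum_two_mul_self (i := i + 1) H (by omega) (by omega)
  have het : evenSum (ray γ l m) (ray β l m) (2 * i + 1 + 1) (i + 1) = 1 :=
    evenSum_two_mul_self (i := i + 1) H.swap (by omega) (by omega)
  refine recursionOne_of_levelRelations (hβ l m) (hγ l m) R R' he het
    (fun j => solution_S hβ hγ rfl j l m) (fun j => solution_S hβ hγ rfl j l (m + 1))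
    (fun j => solution_T hβ hγ rfl j l m) (fun j => solution_T hβ hγ rfl j l (m + 1))
    (fun j => solution_Q hβ hγ (by ring) j l m) (fun j => solution_R hβ hγ (by ring) j l m)
    (solution_P hβ hγ (by ring) H (by omega))
    (solution_A (show 2 * i + 1 + 1 = 2 * (i + 1) by ring) l m) (solution_B rfl l m)
    (solution_B rfl l (m + 1)) ?_ ?_ (ratio_mul_altProd H) (ratio_mul_altProd H.swap)
    (H.ne_zero (2 * i + 1)) (ratio_mul_ratio_swap H) (hbar l m (2 * i + 1) (by omega))
    (solGamma₁_eq i l m hβ) (solGamma₁_eq i l m hγ)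
  · rw [← shift_ray, ← shift_ray, altProd_succ_shift, firstFactor_odd, ray_zero]
  · rw [← shift_ray, ← shift_ray, altProd_succ_shift, firstFactor_odd, ray_zero]

theorem recursionTwo_solution (hβ : ∀ l m, β l m ≠ 0) (hγ : ∀ l m, γ l m ≠ 0)
    (hadm : ∀ l m, Admissible (ray β l m) (ray γ l m) (2 * k))
    (hbar : ∀ l m : ℤ, ∀ n : ℕ, n ≤ 2 * k →
      β (l + 1) m * γ (l + 1) m ≠ β l (m + n) * γ l (m + n)) (hi : i ≤ k) :
    RecursionTwo β γ (solution β γ) i l m ∧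
      lambdaMat β γ (solution β γ) i l m = solLambda β γ i l m := by
  have H : Admissible (ray β l m) (ray γ l m) (2 * i) := (hadm l m).mono (by omega)
  have H' : Admissible (ray β l (m + 1)) (ray γ l (m + 1)) (2 * i) :=
    (hadm l (m + 1)).mono (by omega)
  have Hs : Admissible (shift (ray β l m)) (shift (ray γ l m)) (2 * i) := by
    rwa [shift_ray, shift_ray]
  have R := levelRelations H
  have R' := levelRelations H.swap
  rw [firstFactor_even, shift_ray, shift_ray, ray_zero, ray_zero] at R R'
  refine recursionTwo_of_levelRelations (hβ l m) (hγ l m) R R'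
    (oddSum_two_mul_add_one_self H Hs (by omega))
    (oddSum_two_mul_add_one_self H.swap Hs.swap (by omega))
    (fun j => solution_Q hβ hγ rfl j l m) (fun j => solution_Q hβ hγ rfl j l (m + 1))
    (fun j => solution_R hβ hγ rfl j l m) (fun j => solution_R hβ hγ rfl j l (m + 1))
    (fun j => solution_S hβ hγ rfl j l m) (fun j => solution_T hβ hγ rfl j l m)
    (solution_P hβ hγ rfl H (by omega)) (solution_P hβ hγ rfl H' (by omega))
    (solution_A rfl l m) (solution_B rfl l m) (solution_A rfl l (m + 1)) ?_ ?_
    (ratio_mul_altProd H) (ratio_mul_altProd H.swap) (H.ne_zero (2 * i))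
    (ratio_mul_ratio_swap H) (hbar l m (2 * i) (by omega)) (solLambda₁_eq i l m hγ)
    (solLambda₁_eq i l m hβ)
  · rw [← shift_ray, ← shift_ray, altProd_succ_shift, firstFactor_even, ray_zero]
  · rw [← shift_ray, ← shift_ray, altProd_succ_shift, firstFactor_even, ray_zero]

end Solution

end LMKdV

end
theorem theorem1 (β γ : ℤ → ℤ → ℂ) (k : ℕ)
    (hβ : ∀ l m : ℤ, β l m ≠ 0)
    (hγ : ∀ l m : ℤ, γ l m ≠ 0)
    (hdist : ∀ l m : ℤ, ∀ h : ℕ, 1 ≤ h → h ≤ 2 * k →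
      β l (m + h) * γ l (m + h) ≠ β l m * γ l m)
    (hbar : ∀ l m : ℤ, ∀ n : ℕ, n ≤ 2 * k →
      β (l + 1) m * γ (l + 1) m ≠ β l (m + n) * γ l (m + n)) :
    (∀ i : ℕ, i < k → ∀ l m : ℤ,
      LMKdV.RecursionOne β γ (LMKdV.solution β γ) i l m ∧
      LMKdV.gammaMat β γ (LMKdV.solution β γ) i l m = LMKdV.solGamma β γ i l m) ∧
    (∀ i : ℕ, i ≤ k → ∀ l m : ℤ,
      LMKdV.RecursionTwo β γ (LMKdV.solution β γ) i l m ∧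
      LMKdV.lambdaMat β γ (LMKdV.solution β γ) i l m = LMKdV.solLambda β γ i l m) := by
  have hadm := LMKdV.admissible_ray hβ hγ hdist
  exact ⟨fun i hi l m => LMKdV.recursionOne_solution hβ hγ hadm hbar hi,
    fun i hi l m => LMKdV.recursionTwo_solution hβ hγ hadm hbar hi⟩
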